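/- Let $H^2(\mathbb{D})$ be the Hardy space over the open unit disc $\mathbb{D}$, that is, the Hilbert space of power series $\sum_{m\ge 0} c_m z^m$ with $\sum |c_m|^2<\infty$ in which $\{z^m\}_{m\ge 0}$ is an orthonormal basis, and let $M_z$ be the unilateral shift, $(M_zf)(z)=zf(z)$. A bounded analytic function $\theta$ on $\mathbb{D}$ is called inner if its radial limits have modulus $1$ at almost every point of the unit circle. A linear operator $F$ on $H^2(\mathbb{D})$ is a $1$-perturbation (and $M_z+F$ the corresponding $1$-shift) if $Fz^m=0$ for all $m\ge 1$, $F(z^mH^2(\mathbb{D}))\subseteq z^{m+1}\mathbb{C}[z]$ for all $m\ge 0$, and $M_z+F$ is left-invertible. For a bounded operator $T$ and a vector $f$ let $[f]_T$ be the closure of $\{p(T)f : p\in\mathbb{C}[z]\}$. Let $a_0,b_0\in\mathbb{C}$ with $0<|b_0|\le |a_0|$, and let $F$ be the bounded operator on $H^2(\mathbb{D})$ with $$F1=\big((a_0-1)+b_0z\big)z,\qquad Fz^m=0\quad (m\ge 1).$$ Then $F$ is a $1$-perturbation. Let $S_1=M_z+F$ be the corresponding $1$-shift. A nonzero closed subspace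 $\mathcal{M}\subseteq H^2(\mathbb{D})$ is invariant under $S_1$ if and only if there exists an inner function $\theta$ such that $$\mathcal{M}=\mathbb{C}\varphi\oplus z\theta H^2(\mathbb{D})\quad\text{(orthogonal sum)},$$ where $$\varphi=\Big(1+\frac{b_0}{a_0}|\theta(0)|^2z\Big)\theta-\frac{\theta(0)}{a_0}\Big((a_0-1)+b_0z\Big).$$ Moreover, for every inner function $\theta$, the function $\varphi$ defined by this formula is a nonzero element of $H^2(\mathbb{D})$ orthogonal to $z\theta H^2(\mathbb{D})$, and $$\mathbb{C}\varphi\oplus z\theta H^2(\mathbb{D})=[\varphi]_{S_1}.$$ -/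

import Mathlib

open Filter Topology MeasureTheory Polynomial
open scoped ENNReal InnerProductSpace

noncomputable section

/-- The Hardy space `H²(𝔻)`: the power series `∑ aₙ zⁿ` with square-summable coefficients, with the
inner product for which the monomials `zⁿ` are orthonormal. An element is stored as its coefficient
sequence; the instance `RKHS ℂ HardySpace 𝔻 ℂ` below turns it into a function on the disc. -/
def HardySpace : Type := lp (fun _ : ℕ => ℂ) 2

namespace HardySpace

instance : NormedAddCommGroup HardySpace :=
  inferInstanceAs (NormedAddCommGroup (lp (fun _ : ℕ => ℂ) 2))

instance : InnerProductSpace ℂ HardySpace :=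
  inferInstanceAs (InnerProductSpace ℂ (lp (fun _ : ℕ => ℂ) 2))

instance : CompleteSpace HardySpace :=
  inferInstanceAs (CompleteSpace (lp (fun _ : ℕ => ℂ) 2))

/-- The `n`-th Taylor coefficient at `0`. -/
def coeff (f : HardySpace) (n : ℕ) : ℂ := (show lp (fun _ : ℕ => ℂ) 2 from f) n

/-- The element of `H²` with a given square-summable sequence of Taylor coefficients. -/
def ofCoeff (a : ℕ → ℂ) (ha : Memℓp a 2) : HardySpace :=
  (⟨a, ha⟩ : lp (fun _ : ℕ => ℂ) 2)

@[simp] lemma coeff_ofCoeff (a : ℕ → ℂ) (ha : Memℓp a 2) (n : ℕ) :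
    (ofCoeff a ha).coeff n = a n := rfl

@[simp] lemma coeff_add (f g : HardySpace) (n : ℕ) :
    (f + g).coeff n = f.coeff n + g.coeff n := rfl

@[simp] lemma coeff_smul (c : ℂ) (f : HardySpace) (n : ℕ) :
    (c • f).coeff n = c * f.coeff n := rfl

lemma ext_coeff {f g : HardySpace} (h : ∀ n, f.coeff n = g.coeff n) : f = g :=
  lp.ext (funext h)

lemma memℓp_coeff (f : HardySpace) : Memℓp f.coeff 2 :=
  lp.memℓp (show lp (fun _ : ℕ => ℂ) 2 from f)

lemma summable_sq (f : HardySpace) : Summable fun n => ‖f.coeff n‖ ^ 2 := by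
  have h := (memℓp_gen_iff (by norm_num : (0 : ℝ) < (2 : ℝ≥0∞).toReal)).1 f.memℓp_coeff
  simpa using h

lemma inner_eq (f g : HardySpace) : inner ℂ f g = ∑' n, g.coeff n * star (f.coeff n) := rfl

lemma norm_sq_eq (f : HardySpace) : ‖f‖ ^ 2 = ∑' n, ‖f.coeff n‖ ^ 2 := by
  have h := lp.norm_rpow_eq_tsum (by norm_num : (0 : ℝ) < (2 : ℝ≥0∞).toReal)
    (show lp (fun _ : ℕ => ℂ) 2 from f)
  simp only [ENNReal.toReal_ofNat, Real.rpow_ofNat] at h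
  exact h

/-- The Szegő kernel function `k_w(z) = (1 - z w̄)⁻¹`. -/
def szego (w : ℂ) (hw : ‖w‖ < 1) : HardySpace :=
  ofCoeff (fun n => star w ^ n) (memℓp_gen (by
    have : Summable fun n : ℕ => (‖w‖ ^ 2) ^ n :=
      summable_geometric_of_lt_one (by positivity) (by nlinarith [norm_nonneg w])
    simpa [← pow_mul, mul_comm] using this))

lemma summable_eval (f : HardySpace) {z : ℂ} (hz : ‖z‖ < 1) :
    Summable fun n => f.coeff n * z ^ n := by
  have h : Summable fun n => f.coeff n * star ((szego z hz).coeff n) := lp.summable_inner (𝕜 := ℂ)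
    (show lp (fun _ : ℕ => ℂ) 2 from szego z hz) (show lp (fun _ : ℕ => ℂ) 2 from f)
  simpa [szego] using h

/-- Evaluation of `f = ∑ aₙ zⁿ` at a point of the disc. -/
def evalAt (z : ℂ) (hz : ‖z‖ < 1) : HardySpace →L[ℂ] ℂ where
  toFun f := ∑' n, f.coeff n * z ^ n
  map_add' f g := by
    simp only [coeff_add, add_mul]
    exact (f.summable_eval hz).tsum_add (g.summable_eval hz)
  map_smul' c f := by
    simp only [coeff_smul, mul_assoc, tsum_mul_left, RingHom.id_apply, smul_eq_mul]
  cont := by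
    have h : (fun f : HardySpace => ∑' n, f.coeff n * z ^ n) = fun f => inner ℂ (szego z hz) f := by
      funext f
      simp [inner_eq, szego]
    rw [h]
    fun_prop

lemma coeff_eq_zero_of_eval (f : HardySpace)
    (h : ∀ z : ℂ, ∀ hz : ‖z‖ < 1, evalAt z hz f = 0) : f = 0 := by
  have key : HasFPowerSeriesOnBall (fun _ : ℂ => (0 : ℂ))
      (FormalMultilinearSeries.ofScalars ℂ f.coeff) 0 1 := by
    refine ⟨?_, one_pos, ?_⟩
    · refine ENNReal.le_of_forall_nnreal_lt fun r hr => ?_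
      have hr1 : (r : ℝ) < 1 := by exact_mod_cast hr
      refine FormalMultilinearSeries.le_radius_of_summable_norm _ ?_
      have := (f.summable_eval (z := (r : ℂ)) (by simpa using hr1)).norm
      simpa [FormalMultilinearSeries.ofScalars_norm] using this
    · intro y hy
      have hy1 : ‖y‖ < 1 := by
        have : (‖y‖₊ : ℝ≥0∞) < 1 := by simpa [edist_zero_right, enorm] using hy
        exact_mod_cast this
      have hs := (f.summable_eval hy1).hasSum
      have h0 : ∑' n, f.coeff n * y ^ n = 0 := h y hy1
      rw [h0] at hs
      simpa [FormalMultilinearSeries.ofScalars_apply_eq, mul_comm] using hs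
  have hz := key.hasFPowerSeriesAt.eq_zero
  refine ext_coeff fun n => ?_
  have h1 := congrArg (fun p => FormalMultilinearSeries.coeff p n) hz
  have h2 : FormalMultilinearSeries.coeff (0 : FormalMultilinearSeries ℂ ℂ ℂ) n = 0 := rfl
  simp only [FormalMultilinearSeries.coeff_ofScalars, h2] at h1
  exact h1

instance : RKHS ℂ HardySpace Complex.UnitDisc ℂ where
  coeCLM := ContinuousLinearMap.pi fun z => evalAt (z : ℂ) z.norm_lt_one
  coeCLM_injective := by
    rw [injective_iff_map_eq_zero]
    intro f hf
    exact f.coeff_eq_zero_of_eval fun z hz => congrFun hf (Complex.UnitDisc.mk z hz)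

lemma apply_eq_tsum (f : HardySpace) (z : Complex.UnitDisc) :
    f z = ∑' n, f.coeff n * (z : ℂ) ^ n := rfl

/-- The monomial `zⁿ`. -/
def monomial (n : ℕ) : HardySpace := (lp.single 2 n (1 : ℂ) : lp (fun _ : ℕ => ℂ) 2)

lemma coeff_monomial (n m : ℕ) : (monomial n).coeff m = if m = n then 1 else 0 := by
  simp [coeff, monomial, Pi.single_apply]

lemma monomial_apply (n : ℕ) (z : Complex.UnitDisc) : monomial n z = (z : ℂ) ^ n := by
  simp [apply_eq_tsum, coeff_monomial]

lemma apply_zero (f : HardySpace) : f 0 = f.coeff 0 := by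
  rw [apply_eq_tsum, tsum_eq_single 0 (fun n hn => by simp [hn])]
  simp

/-- The coefficient sequence `0, a₀, a₁, …`. -/
def shiftSeq (a : ℕ → ℂ) : ℕ → ℂ
  | 0 => 0
  | n + 1 => a n

lemma memℓp_shiftSeq (f : HardySpace) : Memℓp (shiftSeq f.coeff) 2 := by
  refine memℓp_gen ?_
  rw [← summable_nat_add_iff 1]
  simpa [shiftSeq] using f.summable_sq

/-- The unilateral shift `M_z` on `H²(𝔻)`. -/
def shift : HardySpace →L[ℂ] HardySpace :=
  LinearIsometry.toContinuousLinearMap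
    { toFun := fun f => ofCoeff (shiftSeq f.coeff) f.memℓp_shiftSeq
      map_add' := fun f g => ext_coeff fun n => by cases n <;> simp [shiftSeq]
      map_smul' := fun c f => ext_coeff fun n => by cases n <;> simp [shiftSeq]
      norm_map' := fun f => by
        have h : ‖ofCoeff (shiftSeq f.coeff) f.memℓp_shiftSeq‖ ^ 2 = ‖f‖ ^ 2 := by
          rw [norm_sq_eq, norm_sq_eq, (HardySpace.summable_sq _).tsum_eq_zero_add]
          simp [shiftSeq]
        exact (sq_eq_sq₀ (norm_nonneg _) (norm_nonneg _)).1 h }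

lemma coeff_shift_zero (f : HardySpace) : (shift f).coeff 0 = 0 := rfl

lemma coeff_shift_succ (f : HardySpace) (n : ℕ) : (shift f).coeff (n + 1) = f.coeff n := rfl

lemma shift_apply (f : HardySpace) (z : Complex.UnitDisc) : shift f z = (z : ℂ) * f z := by
  rw [apply_eq_tsum, apply_eq_tsum, ((shift f).summable_eval z.norm_lt_one).tsum_eq_zero_add,
    ← tsum_mul_left]
  simp only [coeff_shift_zero, coeff_shift_succ, zero_mul, zero_add]
  exact tsum_congr fun n => by ring

/-- For a multiplier `ψ` of `H²(𝔻)`, such as any bounded analytic function on the disc, this is the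
subspace `ψ H²(𝔻)`. Only the values of `ψ` on the disc matter. -/
def multiples (ψ : ℂ → ℂ) : Submodule ℂ HardySpace where
  carrier := {g | ∃ f : HardySpace, ∀ z : Complex.UnitDisc, g z = ψ z * f z}
  zero_mem' := ⟨0, fun z => by simp⟩
  add_mem' := by
    rintro g₁ g₂ ⟨f₁, h₁⟩ ⟨f₂, h₂⟩
    exact ⟨f₁ + f₂, fun z => by simp [h₁ z, h₂ z, mul_add]⟩
  smul_mem' := by
    rintro c g ⟨f, h⟩
    exact ⟨c • f, fun z => by simp [h z, mul_left_comm]⟩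

/-- `F` is an `n`-perturbation: `F zᵐ = 0` for `m ≥ n`, `F (zᵐ H²) ⊆ zᵐ⁺¹ ℂ[z]` for all `m`,
and `M_z + F` is left-invertible. The operator `M_z + F` is then called an `n`-shift. -/
structure IsPerturbation (n : ℕ) (F : HardySpace →L[ℂ] HardySpace) : Prop where
  map_monomial : ∀ m, n ≤ m → F (monomial m) = 0
  map_mul_pow : ∀ (m : ℕ) (f : HardySpace), ∃ p : ℂ[X], ∀ z : Complex.UnitDisc,
    F ((shift ^ m) f) z = (z : ℂ) ^ (m + 1) * p.eval (z : ℂ)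
  left_invertible : ∃ L : HardySpace →L[ℂ] HardySpace,
    L ∘L (shift + F) = ContinuousLinearMap.id ℂ HardySpace

/-- The rank-one operator `F f = f(0) ((a₀ - 1) + b₀ z) z`. -/
def perturbation (a₀ b₀ : ℂ) : HardySpace →L[ℂ] HardySpace :=
  (evalAt 0 (by simp)).smulRight ((a₀ - 1) • monomial 1 + b₀ • monomial 2)

lemma perturbation_apply (a₀ b₀ : ℂ) (f : HardySpace) (z : Complex.UnitDisc) :
    perturbation a₀ b₀ f z = f 0 * (((a₀ - 1) + b₀ * (z : ℂ)) * (z : ℂ)) := by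
  have h : perturbation a₀ b₀ f = f 0 • ((a₀ - 1) • monomial 1 + b₀ • monomial 2) := rfl
  rw [h]
  simp only [RKHS.coe_smul, RKHS.coe_add, Pi.smul_apply, Pi.add_apply, smul_eq_mul, monomial_apply]
  ring

lemma perturbation_monomial (a₀ b₀ : ℂ) (m : ℕ) :
    perturbation a₀ b₀ (monomial m) =
      if m = 0 then (a₀ - 1) • monomial 1 + b₀ • monomial 2 else 0 := by
  have h : perturbation a₀ b₀ (monomial m) =
      monomial m 0 • ((a₀ - 1) • monomial 1 + b₀ • monomial 2) := rfl
  rw [h, monomial_apply]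
  by_cases hm : m = 0 <;> simp [hm]

/-- The operator `S₁ = M_z + F` on `H²(𝔻)`. -/
def perturbedShift (a₀ b₀ : ℂ) : HardySpace →L[ℂ] HardySpace :=
  shift + perturbation a₀ b₀

end HardySpace

/-- `θ` restricts to an inner function on the unit disc: it is a bounded analytic function there,
and its radial limits exist and are unimodular at almost every point of the unit circle. -/
structure IsInnerFunction (θ : ℂ → ℂ) : Prop where
  analytic : DifferentiableOn ℂ θ (Metric.ball 0 1)
  bounded : ∃ C : ℝ, ∀ z ∈ Metric.ball (0 : ℂ) 1, ‖θ z‖ ≤ C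
  radial_limit : ∀ᵐ t : ℝ, ∃ w : ℂ, ‖w‖ = 1 ∧
    Tendsto (fun r : ℝ => θ (circleMap 0 r t)) (𝓝[<] 1) (𝓝 w)

/-- `[f]_T`, the closure of `{p(T) f : p ∈ ℂ[z]}`. -/
def cyclicSubspace {H : Type*} [NormedAddCommGroup H] [InnerProductSpace ℂ H]
    (T : H →L[ℂ] H) (f : H) : Set H :=
  closure (Set.range fun p : ℂ[X] => aeval T p f)

/-- The function `(1 + (b₀/a₀) |θ(0)|² z) θ(z) - (θ(0)/a₀) ((a₀ - 1) + b₀ z)`. -/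
def wanderingFunction (a₀ b₀ : ℂ) (θ : ℂ → ℂ) (z : ℂ) : ℂ :=
  (1 + b₀ / a₀ * (‖θ 0‖ : ℂ) ^ 2 * z) * θ z - θ 0 / a₀ * ((a₀ - 1) + b₀ * z)

end

/-!
Let `T f = f + f(0) ((a₀ - 1) + b₀ z)` (`HardySpace.straighten`). Since `a₀ ≠ 0` it is invertible, it
fixes every function vanishing at `0`, and `S₁ = M_z T`. Hence `T M_z = M_z` and `T S₁ T⁻¹ = M_z`:
the perturbed shift is similar to the unilateral shift. In particular `S₁` is left-invertible, and
its invariant subspaces are the preimages under `T` of those of `M_z`, which by Beurling's theorem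
are the spaces `θ H²`.

With `c = (b₀ / a₀) |θ(0)|²` the function `φ` satisfies `T φ = (1 + c z) θ`, so that
`T⁻¹ (θ H²) = ℂ φ + z θ H²` (`HardySpace.IsWandering.mem_span_sup_multiples_iff`); the value of `c` is
the one that makes `φ` orthogonal to `z θ H²`. Also `T` carries `[φ]_{S₁}` to the closure of
`{p (1 + c z) θ}`. As `|b₀| ≤ |a₀|` and `|θ(0)| ≤ 1` give `|c| ≤ 1`, the function `1 + c z` is cyclic
for `M_z` (`HardySpace.cyclicSubspace_shift_oneAdd`), and this closure is all of `θ H²`.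

Beurling's theorem is proved with inner functions replaced by wandering unit vectors, that is unit
vectors `Θ` orthogonal to `zⁿ Θ` for `n ≥ 1`. Such a `Θ` acts by multiplication as an isometry of
`H²`, hence is bounded by `1` (test it on the Szegő kernel). The wandering subspace `M ⊖ z M` is at
most one-dimensional, because orthogonal wandering vectors `Θ`, `Ψ` would have
`Θ H² ⊥ Ψ H²` although both contain `Θ Ψ`.

That wandering unit vectors are the inner functions rests on two facts. By Parseval's formula on
circles of radius `r < 1` and dominated convergence, `⟨zⁿ θ, θ⟩` is a Fourier coefficient of `|θ*|²`,
where `θ*` is the radial limit; so an inner function is wandering, and for a wandering `Θ` the bound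
`|Θ*| ≤ 1` together with `‖Θ‖ = 1` forces `|Θ*| = 1` almost everywhere. The existence of the radial
limits of a bounded analytic function (`ae_exists_tendsto_radial`) follows from differentiating a
primitive: it is Lipschitz, so its boundary function is differentiable almost everywhere, and
wherever that is so a Cauchy formula with Poisson-type kernel gives the radial limit.
-/

noncomputable section

open Filter Topology MeasureTheory Polynomial Complex Metric Set
open scoped ENNReal InnerProductSpace ComplexConjugate

/-! ### Coefficients, values and the shift on `H²` -/

namespace HardySpace

@[simp] lemma coeff_zero (n : ℕ) : (0 : HardySpace).coeff n = 0 := rfl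

lemma ext_apply {f g : HardySpace} (h : ∀ z : Complex.UnitDisc, f z = g z) : f = g :=
  DFunLike.coe_injective (funext h)

@[simp] lemma add_apply (f g : HardySpace) (z : Complex.UnitDisc) : (f + g) z = f z + g z := by
  rw [RKHS.coe_add, Pi.add_apply]

@[simp] lemma sub_apply (f g : HardySpace) (z : Complex.UnitDisc) : (f - g) z = f z - g z := by
  rw [RKHS.coe_sub, Pi.sub_apply]

@[simp] lemma smul_apply (c : ℂ) (f : HardySpace) (z : Complex.UnitDisc) :
    (c • f) z = c * f z := by
  rw [RKHS.coe_smul, Pi.smul_apply, smul_eq_mul]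

lemma coeff_eq_inner_monomial (f : HardySpace) (n : ℕ) :
    f.coeff n = inner ℂ (monomial n) f := by
  rw [inner_eq, tsum_eq_single n]
  · simp [coeff_monomial]
  · intro m hm
    simp [coeff_monomial, hm]

lemma apply_eq_inner_szego (f : HardySpace) (z : Complex.UnitDisc) :
    f z = inner ℂ (szego z z.norm_lt_one) f := by
  simp [inner_eq, szego, apply_eq_tsum]

lemma inner_shift_shift (f g : HardySpace) :
    inner ℂ (shift f) (shift g) = inner ℂ f g := by
  have h : Summable fun n => (shift g).coeff n * star ((shift f).coeff n) :=
    lp.summable_inner (𝕜 := ℂ) (show lp (fun _ : ℕ => ℂ) 2 from shift f)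
      (show lp (fun _ : ℕ => ℂ) 2 from shift g)
  rw [inner_eq, inner_eq, h.tsum_eq_zero_add]
  simp [coeff_shift_zero, coeff_shift_succ]

lemma norm_shift (f : HardySpace) : ‖shift f‖ = ‖f‖ := by
  rw [norm_eq_sqrt_re_inner (𝕜 := ℂ), inner_shift_shift, ← norm_eq_sqrt_re_inner]

lemma shift_pow_apply (f : HardySpace) (n : ℕ) (z : Complex.UnitDisc) :
    (shift ^ n) f z = (z : ℂ) ^ n * f z := by
  induction n with
  | zero => simp
  | succ n ih =>
    rw [pow_succ', mul_apply_eq_comp, shift_apply, ih]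
    ring

lemma inner_shift_pow_add (f g : HardySpace) (k m n : ℕ) :
    inner ℂ ((shift ^ (k + m)) f) ((shift ^ (k + n)) g) =
      inner ℂ ((shift ^ m) f) ((shift ^ n) g) := by
  induction k with
  | zero => simp
  | succ k ih =>
    rw [← ih, add_right_comm, add_right_comm k 1 n, pow_succ', pow_succ',
      mul_apply_eq_comp, mul_apply_eq_comp, inner_shift_shift]

/-! ### Wandering vectors and the isometries they generate -/

/-- A wandering unit vector for the shift: its translates `zⁿ Θ` are orthonormal. -/
structure IsWandering (Θ : HardySpace) : Prop where
  norm_eq_one : ‖Θ‖ = 1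
  inner_shift_pow : ∀ n, inner ℂ Θ ((shift ^ (n + 1)) Θ) = 0

namespace IsWandering

variable {Θ : HardySpace}

lemma orthonormal (h : IsWandering Θ) : Orthonormal ℂ fun n : ℕ => (shift ^ n) Θ := by
  constructor
  · intro n
    induction n with
    | zero => simpa using h.norm_eq_one
    | succ n ih =>
      beta_reduce at ih ⊢
      rwa [pow_succ', mul_apply_eq_comp, norm_shift]
  · have key : ∀ m k : ℕ, inner ℂ ((shift ^ m) Θ) ((shift ^ (m + (k + 1))) Θ) = 0 := fun m k => by
      have := inner_shift_pow_add Θ Θ m 0 (k + 1)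
      rw [add_zero] at this
      rw [this]
      simpa using h.inner_shift_pow k
    intro m n hmn
    rcases lt_or_gt_of_ne hmn with h1 | h1
    · obtain ⟨k, rfl⟩ := Nat.exists_eq_add_of_lt h1
      exact key m k
    · obtain ⟨k, rfl⟩ := Nat.exists_eq_add_of_lt h1
      exact inner_eq_zero_symm.1 (key n k)

/-- Multiplication by a wandering unit vector `Θ`, an isometry of `H²` into itself. It is defined by
`zⁿ ↦ zⁿ Θ`. -/
def mul (h : IsWandering Θ) : HardySpace →ₗᵢ[ℂ] HardySpace :=
  h.orthonormal.orthogonalFamily.linearIsometry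

lemma hasSum_mul (h : IsWandering Θ) (f : HardySpace) :
    HasSum (fun n => f.coeff n • (shift ^ n) Θ) (h.mul f) :=
  h.orthonormal.orthogonalFamily.hasSum_linearIsometry (show lp (fun _ : ℕ => ℂ) 2 from f)

lemma mul_apply (h : IsWandering Θ) (f : HardySpace) (z : Complex.UnitDisc) :
    h.mul f z = Θ z * f z := by
  have h1 := (h.hasSum_mul f).mapL (evalAt (z : ℂ) z.norm_lt_one)
  have h2 := (f.summable_eval z.norm_lt_one).hasSum.mul_right (Θ z)
  have h3 : ∀ n, evalAt (z : ℂ) z.norm_lt_one (f.coeff n • (shift ^ n) Θ) =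
      f.coeff n * (z : ℂ) ^ n * Θ z := fun n => by
    rw [map_smul, smul_eq_mul, mul_assoc, ← shift_pow_apply]
    rfl
  simp only [h3] at h1
  rw [mul_comm, apply_eq_tsum f]
  exact h1.unique h2

/-- A wandering unit vector is bounded by `1` on the disc: multiplication by it is an isometry, which
is tested on the Szegő kernel `k` through `Θ(z) k(z) = ⟨k, Θ k⟩` and `k(z) = ‖k‖²`. -/
lemma norm_apply_le_one (h : IsWandering Θ) (z : Complex.UnitDisc) : ‖Θ z‖ ≤ 1 := by
  set k := szego z z.norm_lt_one with hk
  have hkz : k z = inner ℂ k k := apply_eq_inner_szego k z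
  have hpos : 0 < ‖k‖ := by
    refine norm_pos_iff.2 fun h0 => ?_
    have : k.coeff 0 = 1 := by simp [hk, szego]
    rw [h0] at this
    simp at this
  have h1 : ‖Θ z‖ * ‖k‖ ^ 2 ≤ ‖k‖ ^ 2 := by
    calc ‖Θ z‖ * ‖k‖ ^ 2 = ‖h.mul k z‖ := by
          rw [h.mul_apply, hkz, norm_mul, inner_self_eq_norm_sq_to_K]
          simp
      _ = ‖inner ℂ k (h.mul k)‖ := by rw [apply_eq_inner_szego]
      _ ≤ ‖k‖ * ‖h.mul k‖ := norm_inner_le_norm _ _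
      _ = ‖k‖ ^ 2 := by rw [h.mul.norm_map, sq]
  exact le_of_mul_le_mul_right (by simpa using h1) (by positivity)

lemma inner_mul_eq_zero (h : IsWandering Θ) {g : HardySpace}
    (hg : ∀ n, inner ℂ g ((shift ^ n) Θ) = 0) (f : HardySpace) : inner ℂ g (h.mul f) = 0 := by
  have h1 := (h.hasSum_mul f).mapL (innerSL ℂ g)
  have h3 : ∀ n, innerSL ℂ g (f.coeff n • (shift ^ n) Θ) = 0 := fun n => by
    rw [map_smul, innerSL_apply_apply, hg, smul_zero]
  simp only [h3] at h1
  exact (hasSum_zero.unique h1).symm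

/-- Two wandering unit vectors `Θ`, `Ψ` cannot generate orthogonal invariant subspaces, since these
share the function `Θ Ψ`. -/
lemma not_orthogonal (h : IsWandering Θ) {Ψ : HardySpace} (h' : IsWandering Ψ)
    (horth : ∀ m n, inner ℂ ((shift ^ m) Θ) ((shift ^ n) Ψ) = 0) : False := by
  have heq : h.mul Ψ = h'.mul Θ := ext_apply fun z => by
    rw [h.mul_apply, h'.mul_apply, mul_comm]
  have h1 : inner ℂ (h'.mul Θ) (h.mul Ψ) = 0 := h.inner_mul_eq_zero (fun n =>
    inner_eq_zero_symm.1 (h'.inner_mul_eq_zero (horth n) Θ)) Ψ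
  rw [← heq, inner_self_eq_zero] at h1
  have h2 := h.mul.norm_map Ψ
  rw [h1, h'.norm_eq_one, norm_zero] at h2
  exact zero_ne_one h2

end IsWandering

/-- A nonzero vector `g` orthogonal to all its translates `zⁿ g`, `n ≥ 1`, is a wandering vector
after normalisation. -/
lemma isWandering_normalize {g : HardySpace} (hg : g ≠ 0)
    (h : ∀ n, inner ℂ g ((shift ^ (n + 1)) g) = 0) :
    IsWandering (((‖g‖⁻¹ : ℝ) : ℂ) • g) where
  norm_eq_one := by
    rw [norm_smul, Complex.norm_real, norm_inv, norm_norm, inv_mul_cancel₀ (norm_ne_zero_iff.2 hg)]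
  inner_shift_pow n := by rw [map_smul, inner_smul_left, inner_smul_right, h, mul_zero, mul_zero]

/-! ### Invariant subspaces of the shift -/

section Beurling

variable {M : Submodule ℂ HardySpace}

lemma shift_pow_mem (hinv : ∀ f ∈ M, shift f ∈ M) {f : HardySpace} (hf : f ∈ M) (n : ℕ) :
    (shift ^ n) f ∈ M := by
  induction n with
  | zero => simpa using hf
  | succ n ih =>
    rw [pow_succ', mul_apply_eq_comp]
    exact hinv _ ih

/-- A set of functions each of which is `z` times another member contains only `0`. -/
lemma eq_zero_of_forall_exists_shift {s : Set HardySpace}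
    (hs : ∀ f ∈ s, ∃ g ∈ s, f = shift g) {f : HardySpace} (hf : f ∈ s) : f = 0 := by
  suffices h : ∀ n, ∀ f ∈ s, f.coeff n = 0 from ext_coeff fun n => by simpa using h n f hf
  intro n
  induction n with
  | zero =>
    intro f hf
    obtain ⟨g, -, rfl⟩ := hs f hf
    exact coeff_shift_zero g
  | succ n ih =>
    intro f hf
    obtain ⟨g, hg, rfl⟩ := hs f hf
    rw [coeff_shift_succ, ih g hg]

/-- The Wold splitting of an element of a closed invariant subspace `M` into a multiple of `z` and
an element of the wandering subspace `M ⊖ z M`. -/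
lemma exists_shift_add (hcl : IsClosed (M : Set HardySpace)) (hinv : ∀ f ∈ M, shift f ∈ M)
    {f : HardySpace} (hf : f ∈ M) :
    ∃ g ∈ M, ∃ w ∈ M, f = shift g + w ∧ ∀ u ∈ M, inner ℂ (shift u) w = 0 := by
  set N : Submodule ℂ HardySpace := M.map (shift : HardySpace →ₗ[ℂ] HardySpace) with hN
  have hNcl : IsClosed (N : Set HardySpace) := by
    have hiso : Isometry shift := AddMonoidHomClass.isometry_of_norm shift norm_shift
    exact hiso.isClosedEmbedding.isClosedMap _ hcl
  have : CompleteSpace N := hNcl.completeSpace_coe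
  obtain ⟨v, hv, w, hw, hvw⟩ := N.exists_add_mem_mem_orthogonal f
  obtain ⟨g, hg, rfl⟩ := hv
  refine ⟨g, hg, w, ?_, hvw, fun u hu => hw _ ⟨u, hu, rfl⟩⟩
  have : w = f - shift g := by rw [hvw]; simp
  rw [this]
  exact M.sub_mem hf (hinv g hg)

/-- **Beurling's theorem**, with the generator described as a wandering unit vector. -/
theorem exists_isWandering_of_invariant (hM : M ≠ ⊥) (hcl : IsClosed (M : Set HardySpace))
    (hinv : ∀ f ∈ M, shift f ∈ M) :
    ∃ (Θ : HardySpace) (h : IsWandering Θ), ∀ f, f ∈ M ↔ ∃ g, f = h.mul g := by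
  -- if the wandering subspace were zero, every element of `M` could be divided by `z` indefinitely
  obtain ⟨w, hwM, hw0, hw⟩ : ∃ w ∈ M, w ≠ 0 ∧ ∀ u ∈ M, inner ℂ (shift u) w = 0 := by
    by_contra! hcon
    refine hM ((Submodule.eq_bot_iff M).2 fun f hf =>
      eq_zero_of_forall_exists_shift (s := M) (fun f hf => ?_) hf)
    obtain ⟨g, hg, w, hw, hfw, hort⟩ := exists_shift_add hcl hinv hf
    by_cases h0 : w = 0
    · exact ⟨g, hg, by rw [hfw, h0, add_zero]⟩
    · obtain ⟨u, hu, hne⟩ := hcon w hw h0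
      exact absurd (hort u hu) hne
  have hself : ∀ v ∈ M, (∀ u ∈ M, inner ℂ (shift u) v = 0) →
      ∀ u ∈ M, ∀ n, inner ℂ v ((shift ^ (n + 1)) u) = 0 := fun v _ hv u hu n => by
    rw [pow_succ', mul_apply_eq_comp]
    exact inner_eq_zero_symm.1 (hv _ (shift_pow_mem hinv hu n))
  set Θ := ((‖w‖⁻¹ : ℝ) : ℂ) • w with hΘ
  have hΘM : Θ ∈ M := M.smul_mem _ hwM
  have hΘort : ∀ u ∈ M, inner ℂ (shift u) Θ = 0 := fun u hu => by
    rw [hΘ, inner_smul_right, hw u hu, mul_zero]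
  have h : IsWandering Θ := isWandering_normalize hw0 (hself w hwM hw w hwM)
  have hrange : ∀ g, h.mul g ∈ M := fun g =>
    hcl.mem_of_tendsto (h.hasSum_mul g) (Eventually.of_forall fun s =>
      M.sum_mem fun n _ => M.smul_mem _ (shift_pow_mem hinv hΘM n))
  refine ⟨Θ, h, fun f => ⟨fun hf => ?_, ?_⟩⟩
  · -- the part of `f` orthogonal to `Θ H²` can be divided by `z` indefinitely
    set R : Submodule ℂ HardySpace := LinearMap.range h.mul.toLinearMap with hR
    have hRcl : IsClosed (R : Set HardySpace) := by
      have := h.mul.isometry.isClosedEmbedding.isClosed_range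
      exact this
    have : CompleteSpace R := hRcl.completeSpace_coe
    obtain ⟨v, ⟨g, rfl⟩, k, hk, hvk⟩ := R.exists_add_mem_mem_orthogonal f
    have hkM : k ∈ M := by
      have : k = f - h.mul g := by rw [hvk]; simp
      rw [this]
      exact M.sub_mem hf (hrange g)
    have hΘmul : ∀ n, h.mul (monomial n) = (shift ^ n) Θ := fun n => ext_apply fun z => by
      rw [h.mul_apply, monomial_apply, shift_pow_apply, mul_comm]
    have hkort : ∀ n, inner ℂ ((shift ^ n) Θ) k = 0 := fun n =>
      hk _ ⟨monomial n, hΘmul n⟩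
    have hk0 : k = 0 := by
      refine eq_zero_of_forall_exists_shift
        (s := {k | k ∈ M ∧ ∀ n, inner ℂ ((shift ^ n) Θ) k = 0}) ?_ ⟨hkM, hkort⟩
      rintro k ⟨hkM, hkort⟩
      obtain ⟨g, hg, w', hw', hkw, hort⟩ := exists_shift_add hcl hinv hkM
      -- the wandering part `w'` is orthogonal to `Θ` and to all its translates, and vice versa
      have hw'0 : w' = 0 := by
        by_contra hne
        have hΘw' : inner ℂ Θ w' = 0 := by
          have h1 := hkort 0
          rw [hkw, inner_add_right, pow_zero, one_apply_eq_self,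
            inner_eq_zero_symm.1 (hΘort g hg), zero_add] at h1
          exact h1
        have hΨ := isWandering_normalize hne (hself w' hw' hort w' hw')
        refine h.not_orthogonal hΨ fun m n => ?_
        rw [map_smul (shift ^ n), inner_smul_right]
        refine mul_eq_zero_of_right _ ?_
        rcases lt_trichotomy m n with hmn | rfl | hmn
        · obtain ⟨j, rfl⟩ := Nat.exists_eq_add_of_lt hmn
          have := inner_shift_pow_add Θ w' m 0 (j + 1)
          rw [add_zero, ← add_assoc] at this
          rw [this]
          exact hself Θ hΘM hΘort w' hw' j
        · have := inner_shift_pow_add Θ w' m 0 0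
          rw [add_zero] at this
          rw [this]
          exact hΘw'
        · obtain ⟨j, rfl⟩ := Nat.exists_eq_add_of_lt hmn
          have := inner_shift_pow_add Θ w' n (j + 1) 0
          rw [add_zero, ← add_assoc] at this
          rw [this]
          exact inner_eq_zero_symm.1 (hself w' hw' hort Θ hΘM j)
      rw [hw'0, add_zero] at hkw
      refine ⟨g, ⟨hg, fun n => ?_⟩, hkw⟩
      have := hkort (n + 1)
      rwa [hkw, pow_succ', mul_apply_eq_comp, inner_shift_shift] at this
    exact ⟨g, by rw [hvk, hk0, add_zero]; rfl⟩
  · rintro ⟨g, rfl⟩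
    exact hrange g

end Beurling

end HardySpace

/-! ### Radial limits of bounded analytic functions -/

lemma one_sub_le_norm_sub {r : ℝ} (hr0 : 0 ≤ r) {w : ℂ} (hw : ‖w‖ = 1) : 1 - r ≤ ‖w - r‖ := by
  have := norm_sub_norm_le w (r : ℂ)
  rwa [hw, Complex.norm_real, Real.norm_of_nonneg hr0] at this

lemma norm_sub_one_le {r : ℝ} (hr0 : 0 ≤ r) (hr1 : r < 1) {w : ℂ} (hw : ‖w‖ = 1) :
    ‖w - 1‖ ≤ 2 * ‖w - r‖ := by
  have h1 : ‖w - 1‖ ≤ ‖w - r‖ + ‖(r : ℂ) - 1‖ := norm_sub_le_norm_sub_add_norm_sub _ _ _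
  have h2 : ‖(r : ℂ) - 1‖ = 1 - r := by
    rw [← ofReal_one, ← ofReal_sub, Complex.norm_real, Real.norm_eq_abs, abs_of_neg (by linarith)]
    ring
  linarith [one_sub_le_norm_sub hr0 hw]

lemma norm_mul_sub_one {r : ℝ} {w : ℂ} (hw : ‖w‖ = 1) : ‖(r : ℂ) * w - 1‖ = ‖w - r‖ := by
  have hw2 : w.re * w.re + w.im * w.im = 1 := by
    rw [← Complex.normSq_apply, Complex.normSq_eq_norm_sq, hw, one_pow]
  rw [← sq_eq_sq₀ (norm_nonneg _) (norm_nonneg _), ← Complex.normSq_eq_norm_sq,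
    ← Complex.normSq_eq_norm_sq, Complex.normSq_apply, Complex.normSq_apply]
  simp
  linear_combination (r ^ 2 - 1) * hw2

/-- On the unit circle the difference of the Cauchy kernels `(w - r)⁻²` and `(r w - 1)⁻²`, times
`w - 1`, is dominated by the Poisson kernel at `r`. The kernel `(w - r)⁻²` alone would lose a
logarithm. -/
lemma norm_kernel_mul_le {r : ℝ} (hr0 : 0 ≤ r) (hr1 : r < 1) {w : ℂ} (hw : ‖w‖ = 1) :
    ‖((w - r) ^ 2)⁻¹ - ((r * w - 1) ^ 2)⁻¹‖ * ‖w - 1‖ ≤ 8 * ((1 - r ^ 2) / ‖w - r‖ ^ 2) := by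
  have hd : 0 < ‖w - r‖ := lt_of_lt_of_le (by linarith) (one_sub_le_norm_sub hr0 hw)
  have h1 : w - r ≠ 0 := norm_pos_iff.1 hd
  have h2 : (r : ℂ) * w - 1 ≠ 0 := norm_pos_iff.1 (by rwa [norm_mul_sub_one hw])
  have hr2 : 0 ≤ 1 - r ^ 2 := by nlinarith
  have hker : ((w - r) ^ 2)⁻¹ - ((r * w - 1) ^ 2)⁻¹ =
      ((r ^ 2 - 1 : ℝ) : ℂ) * ((w + 1) * (w - 1)) / ((w - r) ^ 2 * (r * w - 1) ^ 2) := by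
    rw [inv_sub_inv (pow_ne_zero 2 h1) (pow_ne_zero 2 h2)]
    congr 1
    push_cast
    ring
  have h3 : ‖w + 1‖ ≤ 2 := (norm_add_le _ _).trans (by rw [hw, norm_one]; norm_num)
  have h4 := norm_sub_one_le hr0 hr1 hw
  rw [hker, norm_div, norm_mul, norm_mul, norm_mul, norm_pow, norm_pow, norm_mul_sub_one hw,
    Complex.norm_real, Real.norm_eq_abs, abs_sub_comm, abs_of_nonneg hr2, div_mul_eq_mul_div,
    ← mul_div_assoc, div_le_div_iff₀ (by positivity) (by positivity)]
  have h5 : ‖w + 1‖ * ‖w - 1‖ ^ 2 ≤ 8 * ‖w - r‖ ^ 2 := by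
    calc ‖w + 1‖ * ‖w - 1‖ ^ 2 ≤ 2 * (2 * ‖w - r‖) ^ 2 := by gcongr
      _ = 8 * ‖w - r‖ ^ 2 := by ring
  calc (1 - r ^ 2) * (‖w + 1‖ * ‖w - 1‖) * ‖w - 1‖ * ‖w - r‖ ^ 2
      = (1 - r ^ 2) * ‖w - r‖ ^ 2 * (‖w + 1‖ * ‖w - 1‖ ^ 2) := by ring
    _ ≤ (1 - r ^ 2) * ‖w - r‖ ^ 2 * (8 * ‖w - r‖ ^ 2) := by gcongr
    _ = 8 * (1 - r ^ 2) * (‖w - r‖ ^ 2 * ‖w - r‖ ^ 2) := by ring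

/-- Cauchy's formula for the derivative at a point `r` of the disc; the kernel of the reflected
point `1 / r` contributes nothing. -/
lemma circleIntegral_kernel_mul {H : ℂ → ℂ} (hH : DiffContOnCl ℂ H (ball 0 1)) {r : ℝ}
    (hr0 : 0 ≤ r) (hr1 : r < 1) :
    ∮ w in C(0, 1), (((w - r) ^ 2)⁻¹ - ((r * w - 1) ^ 2)⁻¹) * H w =
      (2 * Real.pi * I) * deriv H r := by
  have hrb : (r : ℂ) ∈ ball (0 : ℂ) 1 := by simpa [abs_of_nonneg hr0] using hr1
  have hrn : ball (0 : ℂ) 1 ∈ 𝓝 (r : ℂ) := isOpen_ball.mem_nhds hrb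
  have hne1 : ∀ w : ℂ, ‖w‖ = 1 → w - r ≠ 0 := fun w hw =>
    norm_pos_iff.1 (lt_of_lt_of_le (by linarith) (one_sub_le_norm_sub hr0 hw))
  have hne2 : ∀ w : ℂ, ‖w‖ ≤ 1 → (r : ℂ) * w - 1 ≠ 0 := fun w hw h => by
    have h1 : ‖(r : ℂ) * w‖ = 1 := by rw [sub_eq_zero.1 h, norm_one]
    rw [norm_mul, Complex.norm_real, Real.norm_of_nonneg hr0] at h1
    nlinarith [norm_nonneg w]
  have hHc : ContinuousOn H (closedBall 0 1) := hH.continuousOn_ball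
  have hHs : ContinuousOn H (sphere 0 1) := hHc.mono sphere_subset_closedBall
  -- Cauchy's formula for the difference quotient of `H` at `r`
  have hA : ∮ w in C(0, 1), (w - r)⁻¹ * dslope H r w = (2 * Real.pi * I) * deriv H r := by
    have hd : DiffContOnCl ℂ (dslope H r) (ball 0 1) := by
      refine ⟨(Complex.differentiableOn_dslope hrn).2 hH.differentiableOn, ?_⟩
      rw [closure_ball _ one_ne_zero, continuousOn_dslope (mem_of_superset hrn ball_subset_closedBall)]
      exact ⟨hHc, hH.differentiableAt isOpen_ball hrb⟩
    have := hd.circleIntegral_sub_inv_smul hrb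
    simpa [smul_eq_mul] using this
  have hB : ∮ w in C(0, 1), (w - r)⁻¹ * dslope H r w = ∮ w in C(0, 1), ((w - r) ^ 2)⁻¹ * H w := by
    have h1 : ∮ w in C(0, 1), (w - r)⁻¹ * dslope H r w =
        ∮ w in C(0, 1), (((w - r) ^ 2)⁻¹ * H w - (w - r) ^ (-2 : ℤ) * H r) := by
      refine circleIntegral.integral_congr zero_le_one fun w hw => ?_
      have hw0 := hne1 w (by simpa using hw)
      rw [dslope_of_ne _ (sub_ne_zero.1 hw0), slope_def_field]
      simp only [zpow_neg]
      field_simp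
    rw [h1, circleIntegral.integral_sub]
    · have h2 : (∮ w in C(0, 1), (w - r) ^ (-2 : ℤ) * H r) = 0 := by
        have := circleIntegral.integral_smul_const (fun w : ℂ => (w - r) ^ (-2 : ℤ)) (H r) 0 1
        rw [circleIntegral.integral_sub_zpow_of_ne (by norm_num)] at this
        simpa using this
      rw [h2, sub_zero]
    · refine ContinuousOn.circleIntegrable zero_le_one (ContinuousOn.mul ?_ hHs)
      exact ContinuousOn.inv₀ (by fun_prop) fun w hw => pow_ne_zero 2 (hne1 w (by simpa using hw))
    · refine ContinuousOn.circleIntegrable zero_le_one (ContinuousOn.mul ?_ continuousOn_const)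
      exact ContinuousOn.zpow₀ (by fun_prop) _ fun w hw => Or.inl (hne1 w (by simpa using hw))
  have hC : ∮ w in C(0, 1), ((r * w - 1) ^ 2)⁻¹ * H w = 0 := by
    refine Complex.circleIntegral_eq_zero_of_differentiable_on_off_countable zero_le_one
      Set.countable_empty (ContinuousOn.mul ?_ hHc) fun w hw => ?_
    · exact ContinuousOn.inv₀ (by fun_prop) fun w hw => pow_ne_zero 2 (hne2 w (by simpa using hw))
    · have hw' : w ∈ ball (0 : ℂ) 1 := hw.1
      refine DifferentiableAt.mul (DifferentiableAt.inv (by fun_prop) ?_)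
        (hH.differentiableAt isOpen_ball hw')
      exact pow_ne_zero 2 (hne2 w (by simpa using (ball_subset_closedBall hw')))
  rw [← hA, hB]
  simp only [sub_mul]
  rw [circleIntegral.integral_sub, hC, sub_zero]
  · refine ContinuousOn.circleIntegrable zero_le_one (ContinuousOn.mul ?_ hHs)
    exact ContinuousOn.inv₀ (by fun_prop) fun w hw => pow_ne_zero 2 (hne1 w (by simpa using hw))
  · refine ContinuousOn.circleIntegrable zero_le_one (ContinuousOn.mul ?_ hHs)
    exact ContinuousOn.inv₀ (by fun_prop) fun w hw =>
      pow_ne_zero 2 (hne2 w (by simp at hw; exact hw.le))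

lemma continuous_poisson {r : ℝ} (hr0 : 0 ≤ r) (hr1 : r < 1) :
    Continuous fun t : ℝ => (1 - r ^ 2) / ‖circleMap 0 1 t - r‖ ^ 2 := by
  refine Continuous.div (by fun_prop) (by fun_prop) fun t => pow_ne_zero 2 (ne_of_gt ?_)
  exact lt_of_lt_of_le (by linarith) (one_sub_le_norm_sub hr0 (by simp))

lemma integral_poisson {r : ℝ} (hr0 : 0 ≤ r) (hr1 : r < 1) :
    ∫ t in (0 : ℝ)..2 * Real.pi, (1 - r ^ 2) / ‖circleMap 0 1 t - r‖ ^ 2 = 2 * Real.pi := by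
  have h := (diffContOnCl_const (c := (1 : ℂ)) (s := ball (0 : ℂ) 1)).circleAverage_poissonKernel_smul'
    (w := r) (c := 0) (R := 1) (by simpa [abs_of_nonneg hr0] using hr1)
  simp only [sub_zero, Real.circleAverage_def, Complex.norm_real, norm_circleMap_zero,
    abs_one, one_pow, Real.norm_of_nonneg hr0, real_smul, mul_one] at h
  rw [intervalIntegral.integral_ofReal] at h
  have h2 : (2 * Real.pi)⁻¹ * ∫ t in (0 : ℝ)..2 * Real.pi,
      (1 - r ^ 2) / ‖circleMap 0 1 t - r‖ ^ 2 = 1 := by exact_mod_cast h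
  have := Real.pi_pos
  field_simp at h2
  linarith

/-- If a Lipschitz function, analytic in the disc, is flat at the boundary point `1` along the
circle, then its derivative has radial limit `0` there. -/
lemma tendsto_deriv_of_isLittleO {H : ℂ → ℂ} {K : NNReal} (hK : LipschitzWith K H)
    (hH : DifferentiableOn ℂ H (ball 0 1)) (h1 : H 1 = 0)
    (ho : H =o[𝓝[sphere 0 1] 1] fun w => w - 1) :
    Tendsto (fun r : ℝ => deriv H r) (𝓝[<] 1) (𝓝 0) := by
  have hHcl : DiffContOnCl ℂ H (ball 0 1) := ⟨hH, hK.continuous.continuousOn⟩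
  rw [Metric.tendsto_nhds]
  intro ε' hε'
  obtain ⟨ε, hε, rfl⟩ : ∃ ε, 0 < ε ∧ ε' = 9 * ε := ⟨ε' / 9, by positivity, by ring⟩
  have hev := ho.def hε
  rw [eventually_nhdsWithin_iff, Metric.eventually_nhds_iff] at hev
  obtain ⟨δ, hδ, hnear⟩ := hev
  have hbound : ∀ r : ℝ, 0 ≤ r → r < 1 →
      ‖deriv H r‖ ≤ 8 * ε + 32 * K / δ ^ 2 * (1 - r ^ 2) := by
    intro r hr0 hr1
    have hr2 : 0 ≤ 1 - r ^ 2 := by nlinarith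
    set B : ℝ → ℝ := fun t => 8 * ε * ((1 - r ^ 2) / ‖circleMap 0 1 t - r‖ ^ 2) +
      32 * K / δ ^ 2 * (1 - r ^ 2) with hB
    have hpt : ∀ t : ℝ, ‖deriv (circleMap 0 1) t • ((((circleMap 0 1 t - r) ^ 2)⁻¹ -
        ((r * circleMap 0 1 t - 1) ^ 2)⁻¹) * H (circleMap 0 1 t))‖ ≤ B t := by
      intro t
      set w := circleMap 0 1 t with hwdef
      have hw : ‖w‖ = 1 := by simp [hwdef]
      have hker := norm_kernel_mul_le hr0 hr1 hw
      set k := ((w - r) ^ 2)⁻¹ - ((r * w - 1) ^ 2)⁻¹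
      have hp : 0 ≤ (1 - r ^ 2) / ‖w - r‖ ^ 2 := by positivity
      rw [deriv_circleMap, norm_smul, norm_mul, norm_mul, norm_I, mul_one, norm_circleMap_zero,
        abs_one, one_mul]
      -- flatness controls the kernel near `1`; away from `1` the factor `1 - r²` does
      rcases lt_or_ge (dist w 1) δ with hlt | hge
      · have h2 : ‖H w‖ ≤ ε * ‖w - 1‖ := hnear hlt (by simpa using hw)
        calc ‖k‖ * ‖H w‖ ≤ ‖k‖ * (ε * ‖w - 1‖) := by gcongr
          _ = ε * (‖k‖ * ‖w - 1‖) := by ring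
          _ ≤ ε * (8 * ((1 - r ^ 2) / ‖w - r‖ ^ 2)) := by gcongr
          _ = 8 * ε * ((1 - r ^ 2) / ‖w - r‖ ^ 2) := by ring
          _ ≤ B t := le_add_of_nonneg_right (by positivity)
      · have h2 : ‖H w‖ ≤ K * ‖w - 1‖ := by
          have := hK.dist_le_mul w 1
          rwa [dist_eq_norm, dist_eq_norm, h1, sub_zero] at this
        rw [dist_eq_norm] at hge
        have h3 : δ / 2 ≤ ‖w - r‖ := by linarith [norm_sub_one_le hr0 hr1 hw]
        calc ‖k‖ * ‖H w‖ ≤ ‖k‖ * (K * ‖w - 1‖) := by gcongr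
          _ = K * (‖k‖ * ‖w - 1‖) := by ring
          _ ≤ K * (8 * ((1 - r ^ 2) / ‖w - r‖ ^ 2)) := by gcongr
          _ ≤ K * (8 * ((1 - r ^ 2) / (δ / 2) ^ 2)) := by gcongr
          _ = 32 * K / δ ^ 2 * (1 - r ^ 2) := by field_simp; ring
          _ ≤ B t := le_add_of_nonneg_left (by positivity)
    have hBc : Continuous B := ((continuous_poisson hr0 hr1).const_mul _).add continuous_const
    have hle : ‖∮ w in C(0, 1), (((w - r) ^ 2)⁻¹ - ((r * w - 1) ^ 2)⁻¹) * H w‖ ≤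
        ∫ t in (0 : ℝ)..2 * Real.pi, B t :=
      intervalIntegral.norm_integral_le_of_norm_le Real.two_pi_pos.le
        (Eventually.of_forall fun t _ => hpt t) (hBc.intervalIntegrable _ _)
    have hBi : ∫ t in (0 : ℝ)..2 * Real.pi, B t =
        2 * Real.pi * (8 * ε + 32 * K / δ ^ 2 * (1 - r ^ 2)) := by
      rw [hB, intervalIntegral.integral_add
        (((continuous_poisson hr0 hr1).const_mul _).intervalIntegrable _ _)
        (continuous_const.intervalIntegrable _ _), intervalIntegral.integral_const_mul,
        integral_poisson hr0 hr1, intervalIntegral.integral_const, smul_eq_mul]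
      ring
    rw [circleIntegral_kernel_mul hHcl hr0 hr1, hBi, norm_mul] at hle
    have h2pi : ‖(2 * Real.pi * I : ℂ)‖ = 2 * Real.pi := by
      simp [abs_of_pos Real.pi_pos]
    rw [h2pi] at hle
    exact le_of_mul_le_mul_left hle Real.two_pi_pos
  have hlim : Tendsto (fun r : ℝ => 8 * ε + 32 * K / δ ^ 2 * (1 - r ^ 2)) (𝓝[<] 1)
      (𝓝 (8 * ε)) := by
    have hc : Continuous fun r : ℝ => 8 * ε + 32 * K / δ ^ 2 * (1 - r ^ 2) := by fun_prop
    have := hc.tendsto 1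
    simp only [one_pow, sub_self, mul_zero, add_zero] at this
    exact this.mono_left nhdsWithin_le_nhds
  have h0 : ∀ᶠ r : ℝ in 𝓝[<] 1, 0 < r :=
    nhdsWithin_le_nhds (lt_mem_nhds one_pos)
  filter_upwards [hlim.eventually (gt_mem_nhds (by linarith : 8 * ε < 9 * ε)), h0,
    self_mem_nhdsWithin] with r hr hr0 hr1
  rw [dist_zero_right]
  exact (hbound r hr0.le hr1).trans_lt hr

/-- The radial limit of `G'` exists wherever the boundary function of `G` is differentiable. -/
lemma exists_tendsto_deriv_radial {G : ℂ → ℂ} {K : NNReal} (hK : LipschitzWith K G)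
    (hG : DifferentiableOn ℂ G (ball 0 1)) {t : ℝ}
    (hd : DifferentiableAt ℝ (fun s : ℝ => G (circleMap 0 1 s)) t) :
    ∃ w, Tendsto (fun r : ℝ => deriv G (circleMap 0 r t)) (𝓝[<] 1) (𝓝 w) := by
  set ζ := circleMap 0 1 t with hζ
  have hζn : ‖ζ‖ = 1 := by simp [hζ]
  have hζ0 : ζ ≠ 0 := norm_ne_zero_iff.1 (by rw [hζn]; exact one_ne_zero)
  set d := deriv (fun s : ℝ => G (circleMap 0 1 s)) t with hd'
  -- rotate the boundary point to `1` and subtract the linear part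
  set H : ℂ → ℂ := fun w => G (ζ * w) - (G ζ + d / I * (w - 1)) with hHdef
  have hmaps : ∀ w ∈ ball (0 : ℂ) 1, ζ * w ∈ ball (0 : ℂ) 1 := fun w hw => by
    simpa [norm_mul, hζn] using hw
  have hGr : ∀ w ∈ ball (0 : ℂ) 1, HasDerivAt (fun w => G (ζ * w)) (deriv G (ζ * w) * ζ) w := by
    intro w hw
    have h1 := ((hG _ (hmaps w hw)).differentiableAt (isOpen_ball.mem_nhds (hmaps w hw))).hasDerivAt
    have h2 := h1.comp w ((hasDerivAt_id w).const_mul ζ)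
    rw [mul_one] at h2
    exact h2
  have hHd : ∀ w ∈ ball (0 : ℂ) 1, HasDerivAt H (deriv G (ζ * w) * ζ - d / I) w := fun w hw => by
    have h2 := (((hasDerivAt_id w).sub_const (1 : ℂ)).const_mul (d / I)).const_add (G ζ)
    rw [mul_one] at h2
    exact (hGr w hw).sub h2
  have hHL : ∃ K' : NNReal, LipschitzWith K' H := by
    have hm : ∀ c : ℂ, LipschitzWith ‖c‖₊ fun w : ℂ => c * w := fun c => lipschitzWith_smul c
    refine ⟨_, (hK.comp (hm ζ)).sub (((LipschitzWith.const (G ζ)).add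
      ((hm (d / I)).comp (LipschitzWith.id.sub (LipschitzWith.const (1 : ℂ))))))⟩
  obtain ⟨K', hK'⟩ := hHL
  have ho : H =o[𝓝[sphere 0 1] 1] fun w => w - 1 := by
    -- parametrise the circle near `1` by `w = exp (i arg w)`
    have harg : HasDerivAt (fun s : ℝ => H (circleMap 0 1 s)) 0 0 := by
      have e1 : HasDerivAt (fun s : ℝ => G (circleMap 0 1 (t + s))) d 0 := by
        have h := hd.hasDerivAt
        rw [← hd'] at h
        have h' : HasDerivAt (fun s : ℝ => G (circleMap 0 1 s)) d (t + 0) := by rwa [add_zero]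
        exact h'.comp_const_add t 0
      have e2 : HasDerivAt (circleMap 0 1) I 0 := by
        simpa [circleMap] using hasDerivAt_circleMap 0 1 0
      have e3 := ((e2.sub_const (1 : ℂ)).const_mul (d / I)).const_add (G ζ)
      have e4 := e1.sub e3
      rw [div_mul_cancel₀ _ I_ne_zero, sub_self] at e4
      refine e4.congr_of_eventuallyEq (Eventually.of_forall fun s => ?_)
      simp [hHdef, hζ, circleMap, ← Complex.exp_add, add_mul]
    have hH1 : H (circleMap 0 1 0) = 0 := by simp [hHdef, circleMap]
    have harg0 := hasDerivAt_iff_isLittleO_nhds_zero.1 harg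
    simp only [zero_add, hH1, sub_zero, smul_zero] at harg0
    have hcont : Tendsto Complex.arg (𝓝[sphere 0 1] 1) (𝓝 0) := by
      have := (Complex.continuousAt_arg (x := 1) (by simp)).tendsto
      rw [Complex.arg_one] at this
      exact this.mono_left nhdsWithin_le_nhds
    have h5 := harg0.comp_tendsto hcont
    have h6 : (fun w : ℂ => Complex.arg w) =O[𝓝[sphere 0 1] 1] fun w => w - 1 := by
      have h7 := (Complex.hasStrictDerivAt_log (x := 1) (by simp)).hasDerivAt.isBigO_sub
      simp only [Complex.log_one, sub_zero] at h7
      refine (Asymptotics.IsBigO.trans ?_ h7).mono nhdsWithin_le_nhds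
      refine Asymptotics.IsBigO.of_bound 1 (Eventually.of_forall fun w => ?_)
      rw [one_mul, Real.norm_eq_abs, ← Complex.log_im]
      exact Complex.abs_im_le_norm _
    refine (h5.trans_isBigO h6).congr' ?_ EventuallyEq.rfl
    filter_upwards [self_mem_nhdsWithin] with w hw
    have hw1 : ‖w‖ = 1 := by simpa using hw
    have : circleMap 0 1 (arg w) = w := by
      have := Complex.norm_mul_exp_arg_mul_I w
      rw [hw1] at this
      simpa [circleMap] using this
    simp only [Function.comp_apply, this]
  have h1 := tendsto_deriv_of_isLittleO hK'
    (fun w hw => (hHd w hw).differentiableAt.differentiableWithinAt) (by simp [hHdef]) ho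
  refine ⟨d / I / ζ, ?_⟩
  have h2 := (h1.add_const (d / I)).div_const ζ
  rw [zero_add] at h2
  refine h2.congr' ?_
  have h0 : ∀ᶠ r : ℝ in 𝓝[<] 1, 0 < r := nhdsWithin_le_nhds (lt_mem_nhds one_pos)
  filter_upwards [h0, self_mem_nhdsWithin] with r hr0 hr1
  have hr : (r : ℂ) ∈ ball (0 : ℂ) 1 := by simpa [abs_of_pos hr0] using hr1
  rw [(hHd _ hr).deriv, sub_add_cancel, mul_div_cancel_right₀ _ hζ0]
  congr 1
  simp [hζ, circleMap, mul_comm]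

/-- **Fatou's theorem** for bounded analytic functions: radial limits exist almost everywhere. The
primitive is Lipschitz, so its boundary function is differentiable almost everywhere. -/
theorem ae_exists_tendsto_radial {θ : ℂ → ℂ} (hθ : DifferentiableOn ℂ θ (ball 0 1)) {C : ℝ}
    (hC : ∀ z ∈ ball (0 : ℂ) 1, ‖θ z‖ ≤ C) :
    ∀ᵐ t : ℝ, ∃ w, Tendsto (fun r : ℝ => θ (circleMap 0 r t)) (𝓝[<] 1) (𝓝 w) := by
  obtain ⟨G₀, hG₀⟩ := hθ.isExactOn_ball
  have hLip : LipschitzOnWith C.toNNReal G₀ (ball 0 1) :=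
    (convex_ball 0 1).lipschitzOnWith_of_nnnorm_hasDerivWithin_le
      (fun z hz => (hG₀ z hz).hasDerivWithinAt) fun z hz => by
        rw [← NNReal.coe_le_coe, coe_nnnorm]
        exact (hC z hz).trans (Real.le_coe_toNNReal C)
  obtain ⟨G, hGK, hGeq⟩ := hLip.extend_finite_dimension
  have hGd : ∀ z ∈ ball (0 : ℂ) 1, HasDerivAt G (θ z) z := fun z hz =>
    (hG₀ z hz).congr_of_eventuallyEq
      (mem_of_superset (isOpen_ball.mem_nhds hz) fun w hw => (hGeq hw).symm)
  have hb := hGK.comp (lipschitzWith_circleMap 0 1)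
  filter_upwards [hb.ae_differentiableAt_real] with t ht
  obtain ⟨w, hw⟩ := exists_tendsto_deriv_radial hGK
    (fun z hz => (hGd z hz).differentiableAt.differentiableWithinAt) ht
  refine ⟨w, hw.congr' ?_⟩
  have h0 : ∀ᶠ r : ℝ in 𝓝[<] 1, 0 < r := nhdsWithin_le_nhds (lt_mem_nhds one_pos)
  filter_upwards [h0, self_mem_nhdsWithin] with r hr0 hr1
  exact (hGd _ (by simpa [abs_of_pos hr0] using hr1)).deriv

/-! ### Parseval's formula on circles -/

lemma circleMap_zero_mem_ball {r : ℝ} (hr0 : 0 ≤ r) (hr1 : r < 1) (t : ℝ) :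
    circleMap 0 r t ∈ ball (0 : ℂ) 1 := by
  simpa [abs_of_nonneg hr0] using hr1

lemma integral_circleMap_pow_mul_conj (r x : ℝ) (m n : ℕ) :
    ∫ t in x..x + 2 * Real.pi, circleMap 0 r t ^ m * conj (circleMap 0 r t ^ n) =
      if m = n then 2 * Real.pi * (r : ℂ) ^ (2 * n) else 0 := by
  have h : ∀ t : ℝ, circleMap 0 r t ^ m * conj (circleMap 0 r t ^ n) =
      (r : ℂ) ^ (m + n) * Complex.exp (((m : ℂ) - n) * I * t) := fun t => by
    have h1 : Complex.exp (((m : ℂ) - n) * I * t) =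
        Complex.exp (t * I) ^ m * Complex.exp (-(t * I)) ^ n := by
      rw [← Complex.exp_nat_mul, ← Complex.exp_nat_mul, ← Complex.exp_add]
      congr 1
      ring
    rw [circleMap_zero, map_pow, map_mul, conj_ofReal, ← Complex.exp_conj, h1]
    simp only [map_mul, conj_ofReal, conj_I, mul_neg]
    ring
  simp only [h, intervalIntegral.integral_const_mul]
  split_ifs with hmn
  · subst hmn
    simp [← two_mul, mul_comm]
  · have hc : ((m : ℂ) - n) * I ≠ 0 :=
      mul_ne_zero (sub_ne_zero.2 (by exact_mod_cast hmn)) I_ne_zero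
    have hper : Complex.exp (((m : ℂ) - n) * I * ((x + 2 * Real.pi : ℝ) : ℂ)) =
        Complex.exp (((m : ℂ) - n) * I * x) := by
      rw [Complex.exp_eq_exp_iff_exists_int]
      exact ⟨(m : ℤ) - n, by push_cast; ring⟩
    rw [integral_exp_mul_complex hc, hper, sub_self, zero_div, mul_zero]

section Parseval

variable {f g : ℂ → ℂ} {a b : ℕ → ℂ} {r : ℝ}

lemma summable_norm_mul_pow (hf : ∀ z ∈ ball (0 : ℂ) 1, HasSum (fun n => a n * z ^ n) (f z))
    (hr0 : 0 ≤ r) (hr1 : r < 1) : Summable fun n => ‖a n‖ * r ^ n := by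
  have h := (hf r (by simpa [abs_of_nonneg hr0] using hr1)).summable.norm
  simpa [abs_of_nonneg hr0] using h

lemma continuous_comp_circleMap
    (hf : ∀ z ∈ ball (0 : ℂ) 1, HasSum (fun n => a n * z ^ n) (f z))
    (hr0 : 0 ≤ r) (hr1 : r < 1) : Continuous fun t => f (circleMap 0 r t) := by
  have h : (fun t => f (circleMap 0 r t)) = fun t => ∑' n, a n * circleMap 0 r t ^ n :=
    funext fun t => ((hf _ (circleMap_zero_mem_ball hr0 hr1 t)).tsum_eq).symm
  rw [h]
  refine continuous_tsum (fun n => by fun_prop) (summable_norm_mul_pow hf hr0 hr1) fun n t => ?_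
  simp [abs_of_nonneg hr0]

/-- A power series may be integrated term by term over a circle inside the disc, against any
continuous weight. -/
lemma hasSum_integral_mul
    (hf : ∀ z ∈ ball (0 : ℂ) 1, HasSum (fun n => a n * z ^ n) (f z))
    (hr0 : 0 ≤ r) (hr1 : r < 1) (x y : ℝ) {k : ℝ → ℂ} (hk : Continuous k) :
    HasSum (fun n => a n * ∫ t in x..y, circleMap 0 r t ^ n * k t)
      (∫ t in x..y, f (circleMap 0 r t) * k t) := by
  have h := intervalIntegral.hasSum_integral_of_dominated_convergence (μ := volume) (a := x) (b := y)
    (F := fun n t => a n * (circleMap 0 r t ^ n * k t))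
    (f := fun t => f (circleMap 0 r t) * k t)
    (fun n t => ‖a n‖ * r ^ n * ‖k t‖)
    (fun n => (Continuous.aestronglyMeasurable (by fun_prop)))
    (fun n => Eventually.of_forall fun t _ => by simp [abs_of_nonneg hr0, mul_assoc])
    (Eventually.of_forall fun t _ => (summable_norm_mul_pow hf hr0 hr1).mul_right _)
    (by
      simp only [tsum_mul_right]
      exact Continuous.intervalIntegrable (by fun_prop) _ _)
    (Eventually.of_forall fun t _ => by
      simpa only [mul_assoc] using
        (hf _ (circleMap_zero_mem_ball hr0 hr1 t)).mul_right (k t))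
  simpa only [intervalIntegral.integral_const_mul] using h

/-- Parseval's formula on the circle of radius `r < 1`. -/
lemma hasSum_parseval
    (hf : ∀ z ∈ ball (0 : ℂ) 1, HasSum (fun n => a n * z ^ n) (f z))
    (hg : ∀ z ∈ ball (0 : ℂ) 1, HasSum (fun n => b n * z ^ n) (g z))
    (hr0 : 0 ≤ r) (hr1 : r < 1) (x : ℝ) :
    HasSum (fun n => a n * conj (b n) * (r : ℂ) ^ (2 * n) * (2 * Real.pi))
      (∫ t in x..x + 2 * Real.pi, f (circleMap 0 r t) * conj (g (circleMap 0 r t))) := by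
  have hgc := continuous_comp_circleMap hg hr0 hr1
  have h := hasSum_integral_mul hf hr0 hr1 x (x + 2 * Real.pi)
    (k := fun t => conj (g (circleMap 0 r t))) (Complex.continuous_conj.comp hgc)
  convert h using 2 with n
  have h2 := hasSum_integral_mul hg hr0 hr1 x (x + 2 * Real.pi)
    (k := fun t => conj (circleMap 0 r t ^ n)) (by fun_prop)
  simp only [integral_circleMap_pow_mul_conj, mul_ite, mul_zero] at h2
  have h3 := (hasSum_ite_eq n (b n * (2 * Real.pi * (r : ℂ) ^ (2 * n)))).unique
    (by convert h2 using 3 with m hm; rw [hm])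
  have h4 : ∀ t, circleMap 0 r t ^ n * conj (g (circleMap 0 r t)) =
      conj (g (circleMap 0 r t) * conj (circleMap 0 r t ^ n)) := fun t => by
    rw [map_mul, conj_conj, mul_comm]
  simp only [h4]
  have h5 : ∫ t in x..x + 2 * Real.pi, conj (g (circleMap 0 r t) * conj (circleMap 0 r t ^ n)) =
      conj (∫ t in x..x + 2 * Real.pi, g (circleMap 0 r t) * conj (circleMap 0 r t ^ n)) := by
    simp only [intervalIntegral, integral_conj, map_sub]
  rw [h5, ← h3]
  simp only [map_mul, map_pow, conj_ofReal, map_ofNat]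
  ring

end Parseval

namespace HardySpace

/-! ### Fourier coefficients of the squared boundary modulus -/

/-- The sum of the power series of `f`, a function on `ℂ` that agrees with `f` on the disc. Outside
the closed disc its values are meaningless. -/
def toFun (f : HardySpace) (z : ℂ) : ℂ := ∑' n, f.coeff n * z ^ n

lemma hasSum_toFun (f : HardySpace) : ∀ z ∈ ball (0 : ℂ) 1,
    HasSum (fun n => f.coeff n * z ^ n) (f.toFun z) := fun z hz =>
  (f.summable_eval (z := z) (by simpa using hz)).hasSum

lemma differentiableOn_toFun (f : HardySpace) : DifferentiableOn ℂ f.toFun (ball 0 1) := by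
  have key : HasFPowerSeriesOnBall f.toFun
      (FormalMultilinearSeries.ofScalars ℂ f.coeff) 0 1 := by
    refine ⟨?_, one_pos, ?_⟩
    · refine ENNReal.le_of_forall_nnreal_lt fun r hr => ?_
      have hr1 : (r : ℝ) < 1 := by exact_mod_cast hr
      refine FormalMultilinearSeries.le_radius_of_summable_norm _ ?_
      have := (f.summable_eval (z := (r : ℂ)) (by simpa using hr1)).norm
      simpa [FormalMultilinearSeries.ofScalars_norm] using this
    · intro y hy
      have hy1 : y ∈ ball (0 : ℂ) 1 := by
        rwa [← ENNReal.coe_one, Metric.eball_coe, NNReal.coe_one] at hy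
      simpa [FormalMultilinearSeries.ofScalars_apply_eq, mul_comm] using f.hasSum_toFun y hy1
  have := key.differentiableOn
  rwa [← ENNReal.coe_one, Metric.eball_coe, NNReal.coe_one] at this

lemma hasSum_of_forall_apply {f : HardySpace} {θ : ℂ → ℂ}
    (h : ∀ z : Complex.UnitDisc, f z = θ z) : ∀ z ∈ ball (0 : ℂ) 1,
    HasSum (fun n => f.coeff n * z ^ n) (θ z) := fun z hz => by
  have hz1 : ‖z‖ < 1 := by simpa using hz
  have := h (Complex.UnitDisc.mk z hz1)
  rw [apply_eq_tsum] at this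
  simp only [Complex.UnitDisc.coe_mk] at this
  rw [← this]
  exact (f.summable_eval hz1).hasSum

lemma tendsto_tsum_radial (f g : HardySpace) :
    Tendsto (fun r : ℝ => ∑' n, g.coeff n * conj (f.coeff n) * (r : ℂ) ^ (2 * n) * (2 * Real.pi))
      (𝓝[<] 1) (𝓝 (2 * Real.pi * inner ℂ f g)) := by
  have hs : Summable fun n => g.coeff n * star (f.coeff n) :=
    lp.summable_inner (𝕜 := ℂ) (show lp (fun _ : ℕ => ℂ) 2 from f)
      (show lp (fun _ : ℕ => ℂ) 2 from g)
  have hlim : 2 * Real.pi * inner ℂ f g =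
      ∑' n, g.coeff n * conj (f.coeff n) * (2 * Real.pi) := by
    rw [inner_eq, tsum_mul_right, mul_comm]
    rfl
  rw [hlim]
  refine tendsto_tsum_of_dominated_convergence
    (bound := fun n => ‖g.coeff n * star (f.coeff n)‖ * (2 * Real.pi))
    (hs.norm.mul_right _) (fun n => ?_) ?_
  · have hc : Continuous fun r : ℝ =>
        g.coeff n * conj (f.coeff n) * (r : ℂ) ^ (2 * n) * (2 * Real.pi) := by fun_prop
    have := hc.tendsto 1
    simp only [ofReal_one, one_pow, mul_one] at this
    exact this.mono_left nhdsWithin_le_nhds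
  · have h0 : ∀ᶠ r : ℝ in 𝓝[<] 1, 0 < r := nhdsWithin_le_nhds (lt_mem_nhds one_pos)
    filter_upwards [h0, self_mem_nhdsWithin] with r hr0 hr1 n
    have hr2 : r ^ (2 * n) ≤ 1 := pow_le_one₀ hr0.le (le_of_lt hr1)
    simp only [norm_mul, norm_pow, Complex.norm_real, Real.norm_of_nonneg hr0.le, RCLike.norm_conj,
      norm_star, Complex.norm_ofNat, Real.norm_of_nonneg Real.pi_pos.le]
    have : 0 ≤ ‖g.coeff n‖ * ‖f.coeff n‖ := by positivity
    refine mul_le_mul_of_nonneg_right (mul_le_of_le_one_right this hr2) (by positivity)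

/-- For a bounded function `θ` of `H²` with radial limits `θ*`, the inner products `⟨zⁿ θ, θ⟩` are
the Fourier coefficients of `|θ*|²`. -/
lemma two_pi_mul_inner_shift_pow {Θ : HardySpace} {θ : ℂ → ℂ} {θs : ℝ → ℂ}
    (hΘ : ∀ z : Complex.UnitDisc, Θ z = θ z) {C : ℝ} (hC : ∀ z ∈ ball (0 : ℂ) 1, ‖θ z‖ ≤ C)
    (hlim : ∀ᵐ t : ℝ, Tendsto (fun r : ℝ => θ (circleMap 0 r t)) (𝓝[<] 1) (𝓝 (θs t)))
    (n : ℕ) (x : ℝ) :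
    2 * Real.pi * inner ℂ Θ ((shift ^ n) Θ) =
      ∫ t in x..x + 2 * Real.pi, circleMap 0 1 t ^ n * ((‖θs t‖ ^ 2 : ℝ) : ℂ) := by
  have hΘs := hasSum_of_forall_apply hΘ
  have hΘn : ∀ z : Complex.UnitDisc, (shift ^ n) Θ z = (fun w => w ^ n * θ w) z := fun z => by
    rw [shift_pow_apply, hΘ]
  have hΘns := hasSum_of_forall_apply (θ := fun w => w ^ n * θ w) hΘn
  have h0 : ∀ᶠ r : ℝ in 𝓝[<] 1, 0 < r := nhdsWithin_le_nhds (lt_mem_nhds one_pos)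
  refine tendsto_nhds_unique (tendsto_tsum_radial Θ ((shift ^ n) Θ)) ?_
  have hDCT : Tendsto (fun r : ℝ => ∫ t in x..x + 2 * Real.pi,
      (circleMap 0 r t ^ n * θ (circleMap 0 r t)) * conj (θ (circleMap 0 r t))) (𝓝[<] 1)
      (𝓝 (∫ t in x..x + 2 * Real.pi, circleMap 0 1 t ^ n * ((‖θs t‖ ^ 2 : ℝ) : ℂ))) := by
    refine intervalIntegral.tendsto_integral_filter_of_dominated_convergence (fun _ => C * C)
      ?_ ?_ intervalIntegrable_const ?_
    · filter_upwards [h0, self_mem_nhdsWithin] with r hr0 hr1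
      have h1 := continuous_comp_circleMap hΘns hr0.le hr1
      have h2 := continuous_comp_circleMap hΘs hr0.le hr1
      exact (h1.mul (Complex.continuous_conj.comp h2)).aestronglyMeasurable
    · filter_upwards [h0, self_mem_nhdsWithin] with r hr0 hr1
      refine Eventually.of_forall fun t _ => ?_
      have h1 := hC _ (circleMap_zero_mem_ball hr0.le hr1 t)
      have h2 : r ^ n ≤ 1 := pow_le_one₀ hr0.le (le_of_lt hr1)
      have h3 : 0 ≤ C := (norm_nonneg _).trans h1
      rw [norm_mul, norm_mul, RCLike.norm_conj, norm_pow, norm_circleMap_zero, abs_of_pos hr0]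
      calc r ^ n * ‖θ (circleMap 0 r t)‖ * ‖θ (circleMap 0 r t)‖ ≤ 1 * C * C := by gcongr
        _ = C * C := by ring
    · filter_upwards [hlim] with t ht _
      have h1 : Tendsto (fun r : ℝ => circleMap 0 r t) (𝓝[<] 1) (𝓝 (circleMap 0 1 t)) := by
        have hc : Continuous fun r : ℝ => circleMap 0 r t := by
          simp only [circleMap]
          fun_prop
        exact (hc.tendsto 1).mono_left nhdsWithin_le_nhds
      have h2 := ((h1.pow n).mul ht).mul ((Complex.continuous_conj.tendsto _).comp ht)
      have hconj : ∀ u v : ℂ, u * v * conj v = u * ((‖v‖ ^ 2 : ℝ) : ℂ) := fun u v => by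
        rw [mul_assoc, Complex.mul_conj, Complex.normSq_eq_norm_sq]
      rwa [hconj] at h2
  refine hDCT.congr' ?_
  filter_upwards [h0, self_mem_nhdsWithin] with r hr0 hr1
  exact ((hasSum_parseval hΘns hΘs hr0.le hr1 x).tsum_eq).symm

end HardySpace

lemma ae_of_forall_ae_restrict_Ioc {p : ℝ → Prop} {T : ℝ} (hT : 0 < T)
    (h : ∀ x : ℝ, ∀ᵐ t ∂(volume.restrict (Ioc x (x + T))), p t) : ∀ᵐ t : ℝ, p t := by
  rw [← Measure.restrict_univ (μ := (volume : Measure ℝ)), ← iUnion_Ioc_zsmul hT,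
    ae_restrict_iUnion_iff]
  intro n
  have := h (n • T)
  rwa [add_smul, one_smul]

namespace HardySpace

/-! ### Inner functions are the wandering unit vectors -/

/-- A wandering unit vector of the shift is an inner function. -/
theorem IsWandering.isInnerFunction {Θ : HardySpace} (h : IsWandering Θ) :
    IsInnerFunction Θ.toFun := by
  have hbd : ∀ z ∈ ball (0 : ℂ) 1, ‖Θ.toFun z‖ ≤ 1 := fun z hz =>
    h.norm_apply_le_one (Complex.UnitDisc.mk z (by simpa using hz))
  refine ⟨Θ.differentiableOn_toFun, ⟨1, hbd⟩, ?_⟩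
  have hae := ae_exists_tendsto_radial Θ.differentiableOn_toFun hbd
  have h0 : ∀ᶠ r : ℝ in 𝓝[<] 1, 0 < r := nhdsWithin_le_nhds (lt_mem_nhds one_pos)
  set θs : ℝ → ℂ := fun t =>
    limUnder (𝓝[<] (1 : ℝ)) fun r : ℝ => Θ.toFun (circleMap 0 r t) with hθs
  have hlim : ∀ᵐ t : ℝ,
      Tendsto (fun r : ℝ => Θ.toFun (circleMap 0 r t)) (𝓝[<] 1) (𝓝 (θs t)) :=
    hae.mono fun t ht => tendsto_nhds_limUnder ht
  have hle : ∀ᵐ t : ℝ, ‖θs t‖ ≤ 1 := hlim.mono fun t ht => by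
    refine le_of_tendsto ht.norm ?_
    filter_upwards [h0, self_mem_nhdsWithin] with r hr0 hr1
    exact hbd _ (circleMap_zero_mem_ball hr0.le hr1 t)
  have hone : ∀ᵐ t : ℝ, 1 - ‖θs t‖ ^ 2 = 0 := by
    refine ae_of_forall_ae_restrict_Ioc Real.two_pi_pos fun x => ?_
    have hx : x ≤ x + 2 * Real.pi := by linarith [Real.pi_pos]
    have hint : ∫ t in x..x + 2 * Real.pi, ‖θs t‖ ^ 2 = 2 * Real.pi := by
      have h1 := two_pi_mul_inner_shift_pow (Θ := Θ) (fun _ => rfl) hbd hlim 0 x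
      simp only [pow_zero, one_apply_eq_self, one_mul] at h1
      rw [intervalIntegral.integral_ofReal, inner_self_eq_norm_sq_to_K, h.norm_eq_one] at h1
      simp only [map_one, one_pow, mul_one] at h1
      exact_mod_cast h1.symm
    -- the integral would be `0` if `‖θs‖²` were not integrable
    have hii : IntervalIntegrable (fun t => ‖θs t‖ ^ 2) volume x (x + 2 * Real.pi) := by
      by_contra hcon
      rw [intervalIntegral.integral_undef hcon] at hint
      linarith [Real.pi_pos]
    have hzero : ∫ t in x..x + 2 * Real.pi, (1 - ‖θs t‖ ^ 2) = 0 := by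
      rw [intervalIntegral.integral_sub intervalIntegrable_const hii, hint]
      simp
    refine (intervalIntegral.integral_eq_zero_iff_of_le_of_nonneg_ae hx ?_
      (intervalIntegrable_const.sub hii)).1 hzero
    refine ae_restrict_of_ae (hle.mono fun t ht => ?_)
    simp only [Pi.zero_apply, sub_nonneg]
    exact pow_le_one₀ (norm_nonneg _) ht
  filter_upwards [hlim, hone] with t ht h1
  refine ⟨θs t, ?_, ht⟩
  have : ‖θs t‖ ^ 2 = 1 := by linarith
  exact (pow_eq_one_iff_of_nonneg (norm_nonneg _) two_ne_zero).1 this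

end HardySpace

/-- An inner function belongs to `H²` and is a wandering unit vector of the shift. -/
theorem IsInnerFunction.exists_isWandering {θ : ℂ → ℂ} (hθ : IsInnerFunction θ) :
    ∃ Θ : HardySpace, HardySpace.IsWandering Θ ∧ ∀ z : Complex.UnitDisc, Θ z = θ z := by
  obtain ⟨C, hC⟩ := hθ.bounded
  set a : ℕ → ℂ := fun n => (n.factorial : ℂ)⁻¹ * iteratedDeriv n θ 0 with ha
  have hsum : ∀ z ∈ ball (0 : ℂ) 1, HasSum (fun n => a n * z ^ n) (θ z) := fun z hz => by
    have := Complex.hasSum_taylorSeries_on_ball hθ.analytic hz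
    simp only [sub_zero, smul_eq_mul] at this
    have heq : (fun n => a n * z ^ n) =
        fun n => (n.factorial : ℂ)⁻¹ * (z ^ n * iteratedDeriv n θ 0) := funext fun n => by
      simp only [ha]
      ring
    rwa [heq]
  -- Parseval's formula bounds the partial sums of `∑ ‖aₙ‖²`
  have hpart : ∀ r : ℝ, 0 < r → r < 1 → ∀ N,
      ∑ n ∈ Finset.range N, ‖a n‖ ^ 2 * r ^ (2 * n) ≤ C ^ 2 := by
    intro r hr0 hr1 N
    have h1 := hasSum_parseval hsum hsum hr0.le hr1 0
    have hc := continuous_comp_circleMap hsum hr0.le hr1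
    have h2 : HasSum (fun n => ‖a n‖ ^ 2 * r ^ (2 * n) * (2 * Real.pi))
        (∫ t in (0 : ℝ)..0 + 2 * Real.pi, ‖θ (circleMap 0 r t)‖ ^ 2) := by
      rw [← Complex.hasSum_ofReal, ← intervalIntegral.integral_ofReal]
      convert h1 using 2 with n
      · rw [Complex.mul_conj, Complex.normSq_eq_norm_sq]
        push_cast
        ring
      · ext t
        rw [Complex.mul_conj, Complex.normSq_eq_norm_sq]
    have h3 : ∫ t in (0 : ℝ)..0 + 2 * Real.pi, ‖θ (circleMap 0 r t)‖ ^ 2 ≤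
        ∫ t in (0 : ℝ)..0 + 2 * Real.pi, C ^ 2 := by
      refine intervalIntegral.integral_mono_on (by linarith [Real.pi_pos])
        ((hc.norm.pow 2).intervalIntegrable _ _) intervalIntegrable_const fun t _ => ?_
      have := hC _ (circleMap_zero_mem_ball hr0.le hr1 t)
      gcongr
    have h4 := sum_le_hasSum (Finset.range N) (fun n _ => by positivity) h2
    rw [← Finset.sum_mul] at h4
    have h5 := h4.trans h3
    rw [intervalIntegral.integral_const, smul_eq_mul, zero_add, sub_zero, mul_comm] at h5
    exact le_of_mul_le_mul_left h5 Real.two_pi_pos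
  have hsq : Summable fun n => ‖a n‖ ^ 2 := by
    refine summable_of_sum_range_le (c := C ^ 2) (fun n => by positivity) fun N => ?_
    have hc : Continuous fun r : ℝ => ∑ n ∈ Finset.range N, ‖a n‖ ^ 2 * r ^ (2 * n) := by fun_prop
    have h1 := hc.tendsto 1
    simp only [one_pow, mul_one] at h1
    have h0 : ∀ᶠ r : ℝ in 𝓝[<] 1, 0 < r := nhdsWithin_le_nhds (lt_mem_nhds one_pos)
    refine le_of_tendsto (h1.mono_left (nhdsWithin_le_nhds (s := Iio 1))) ?_
    filter_upwards [h0, self_mem_nhdsWithin] with r hr0 hr1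
    exact hpart r hr0 hr1 N
  have hmem : Memℓp a 2 := memℓp_gen (by simpa using hsq)
  have happ : ∀ z : Complex.UnitDisc, HardySpace.ofCoeff a hmem z = θ z := fun z =>
    (hsum z (by simpa using z.norm_lt_one)).tsum_eq
  refine ⟨HardySpace.ofCoeff a hmem, ?_, happ⟩
  set Θ := HardySpace.ofCoeff a hmem
  set θs : ℝ → ℂ := fun t => limUnder (𝓝[<] (1 : ℝ)) fun r : ℝ => θ (circleMap 0 r t) with hθs
  have hlim : ∀ᵐ t : ℝ, Tendsto (fun r : ℝ => θ (circleMap 0 r t)) (𝓝[<] 1) (𝓝 (θs t)) :=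
    hθ.radial_limit.mono fun t ⟨w, _, hw⟩ => tendsto_nhds_limUnder ⟨w, hw⟩
  have hone : ∀ᵐ t : ℝ, ‖θs t‖ = 1 := by
    filter_upwards [hθ.radial_limit, hlim] with t ⟨w, hw1, hw⟩ ht
    rw [tendsto_nhds_unique ht hw, hw1]
  have hinner : ∀ n, 2 * Real.pi * inner ℂ Θ ((HardySpace.shift ^ n) Θ) =
      if n = 0 then (2 * Real.pi : ℂ) else 0 := fun n => by
    rw [HardySpace.two_pi_mul_inner_shift_pow happ hC hlim n 0]
    have h1 := integral_circleMap_pow_mul_conj 1 0 n 0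
    simp only [pow_zero, map_one, mul_one, mul_zero, ofReal_one] at h1
    rw [← h1]
    refine intervalIntegral.integral_congr_ae (hone.mono fun t ht _ => ?_)
    rw [ht]
    simp
  have hpi : (2 * Real.pi : ℂ) ≠ 0 := by exact_mod_cast Real.two_pi_pos.ne'
  constructor
  · have h1 := hinner 0
    rw [if_pos rfl, pow_zero, one_apply_eq_self, inner_self_eq_norm_sq_to_K] at h1
    have h2 : ((‖Θ‖ : ℂ)) ^ 2 = 1 := mul_left_cancel₀ hpi (by rw [mul_one]; exact h1)
    have h3 : ‖Θ‖ ^ 2 = 1 := by exact_mod_cast h2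
    exact (pow_eq_one_iff_of_nonneg (norm_nonneg _) two_ne_zero).1 h3
  · intro n
    have h1 := hinner (n + 1)
    rw [if_neg n.succ_ne_zero] at h1
    exact (mul_eq_zero.1 h1).resolve_left hpi

/-! ### Division by `z` -/

namespace HardySpace

lemma coe_unitDisc_zero : ((0 : Complex.UnitDisc) : ℂ) = 0 := rfl

lemma shift_apply_zero (f : HardySpace) : shift f 0 = 0 := by
  rw [shift_apply, coe_unitDisc_zero, zero_mul]

/-- A function vanishing at `0` is divisible by `z`. -/
lemma exists_eq_shift {f : HardySpace} (hf : f 0 = 0) : ∃ g, f = shift g := by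
  have hmem : Memℓp (fun n => f.coeff (n + 1)) 2 :=
    memℓp_gen (by simpa using (summable_nat_add_iff 1).2 f.summable_sq)
  refine ⟨ofCoeff _ hmem, ext_coeff fun n => ?_⟩
  cases n with
  | zero => rw [coeff_shift_zero, ← apply_zero, hf]
  | succ n => rw [coeff_shift_succ, coeff_ofCoeff]

/-! ### The conjugation of the perturbed shift to the shift -/

section Straighten

variable {a₀ b₀ : ℂ}

/-- The affine function `(a₀ - 1) + b₀ z`. -/
def affine (a₀ b₀ : ℂ) : HardySpace := (a₀ - 1) • monomial 0 + b₀ • monomial 1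

lemma affine_apply (a₀ b₀ : ℂ) (z : Complex.UnitDisc) :
    affine a₀ b₀ z = (a₀ - 1) + b₀ * z := by
  simp [affine, monomial_apply]

/-- The invertible operator `T f = f + f(0) ((a₀ - 1) + b₀ z)`, which fixes `z H²` pointwise. It
conjugates `S₁ = M_z T` to `M_z = T M_z`. -/
def straighten (b₀ : ℂ) (ha : a₀ ≠ 0) : HardySpace ≃L[ℂ] HardySpace :=
  ContinuousLinearEquiv.equivOfInverse
    (ContinuousLinearMap.id ℂ HardySpace +
      (evalAt 0 (by simp)).smulRight (affine a₀ b₀))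
    (ContinuousLinearMap.id ℂ HardySpace -
      (evalAt 0 (by simp)).smulRight (a₀⁻¹ • affine a₀ b₀))
    (fun f => ext_apply fun z => by
      change (f + f 0 • affine a₀ b₀ - (f + f 0 • affine a₀ b₀) 0 • a₀⁻¹ • affine a₀ b₀) z = f z
      simp only [sub_apply, add_apply, smul_apply, affine_apply, coe_unitDisc_zero]
      field_simp
      ring)
    (fun f => ext_apply fun z => by
      change (f - f 0 • a₀⁻¹ • affine a₀ b₀ + (f - f 0 • a₀⁻¹ • affine a₀ b₀) 0 • affine a₀ b₀) z
        = f z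
      simp only [sub_apply, add_apply, smul_apply, affine_apply, coe_unitDisc_zero]
      field_simp
      ring)

lemma straighten_apply (ha : a₀ ≠ 0) (f : HardySpace) (z : Complex.UnitDisc) :
    straighten b₀ ha f z = f z + f 0 * ((a₀ - 1) + b₀ * z) := by
  change (f + f 0 • affine a₀ b₀) z = _
  rw [add_apply, smul_apply, affine_apply]

lemma straighten_eq_self (ha : a₀ ≠ 0) {f : HardySpace} (hf : f 0 = 0) :
    straighten b₀ ha f = f := ext_apply fun z => by
  rw [straighten_apply, hf, zero_mul, add_zero]

lemma straighten_apply_zero (ha : a₀ ≠ 0) (f : HardySpace) :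
    straighten b₀ ha f 0 = a₀ * f 0 := by
  rw [straighten_apply, coe_unitDisc_zero]
  ring

lemma perturbedShift_apply (ha : a₀ ≠ 0) (f : HardySpace) :
    perturbedShift a₀ b₀ f = shift (straighten b₀ ha f) := ext_apply fun z => by
  change (shift f + perturbation a₀ b₀ f) z = _
  rw [add_apply, shift_apply, perturbation_apply, shift_apply, straighten_apply]
  ring

lemma straighten_perturbedShift (ha : a₀ ≠ 0) (f : HardySpace) :
    straighten b₀ ha (perturbedShift a₀ b₀ f) = shift (straighten b₀ ha f) := by
  rw [perturbedShift_apply ha, straighten_eq_self ha (shift_apply_zero _)]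

theorem isPerturbation_perturbation (ha : a₀ ≠ 0) : IsPerturbation 1 (perturbation a₀ b₀) where
  map_monomial m hm := by rw [perturbation_monomial, if_neg (by omega)]
  map_mul_pow m f := by
    cases m with
    | zero =>
      refine ⟨C (f 0) * (C (a₀ - 1) + C b₀ * X), fun z => ?_⟩
      rw [pow_zero, one_apply_eq_self, perturbation_apply]
      simp
      ring
    | succ m =>
      refine ⟨0, fun z => ?_⟩
      rw [perturbation_apply, pow_succ', mul_apply_eq_comp, shift_apply_zero]
      simp
  left_invertible := by
    refine ⟨(straighten b₀ ha).symm.toContinuousLinearMap ∘L ContinuousLinearMap.adjoint shift,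
      ContinuousLinearMap.ext fun f => ?_⟩
    have h := (ContinuousLinearMap.norm_map_iff_adjoint_comp_self shift).1 norm_shift
    have h1 : ContinuousLinearMap.adjoint shift (shift (straighten b₀ ha f)) =
        straighten b₀ ha f := DFunLike.congr_fun h _
    change (straighten b₀ ha).symm (ContinuousLinearMap.adjoint shift (perturbedShift a₀ b₀ f)) = f
    rw [perturbedShift_apply ha, h1, ContinuousLinearEquiv.symm_apply_apply]

end Straighten

lemma norm_mul_sq_le {a₀ b₀ w : ℂ} (hab : ‖b₀‖ ≤ ‖a₀‖) (hw : ‖w‖ ≤ 1) :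
    ‖b₀ / a₀ * (‖w‖ : ℂ) ^ 2‖ ≤ 1 := by
  rw [norm_mul, norm_div, norm_pow, Complex.norm_real, norm_norm]
  exact mul_le_one₀ (div_le_one_of_le₀ hab (norm_nonneg _)) (by positivity)
    (pow_le_one₀ (norm_nonneg _) hw)

/-! ### Cyclicity of affine functions -/

/-- The function `1 + c z`. -/
def oneAdd (c : ℂ) : HardySpace := monomial 0 + c • monomial 1

lemma oneAdd_apply (c : ℂ) (z : Complex.UnitDisc) : oneAdd c z = 1 + c * z := by
  simp [oneAdd, monomial_apply]

lemma oneAdd_ne_zero (c : ℂ) : oneAdd c ≠ 0 := fun h => by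
  have h1 := oneAdd_apply c 0
  rw [h, coe_unitDisc_zero, mul_zero, add_zero, apply_zero, coeff_zero] at h1
  exact zero_ne_one h1

lemma shift_pow_oneAdd (c : ℂ) (n : ℕ) :
    (shift ^ n) (oneAdd c) = monomial n + c • monomial (n + 1) := ext_apply fun z => by
  rw [shift_pow_apply, oneAdd_apply, add_apply, smul_apply, monomial_apply, monomial_apply]
  ring

/-- For `|c| ≤ 1` the function `1 + c z` is cyclic for the shift: the coefficients of a function
orthogonal to all `zⁿ (1 + c z)` have nondecreasing moduli, so they vanish. -/
theorem cyclicSubspace_shift_oneAdd {c : ℂ} (hc : ‖c‖ ≤ 1) :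
    cyclicSubspace shift (oneAdd c) = univ := by
  let A : ℂ[X] →ₗ[ℂ] HardySpace :=
    { toFun := fun p => aeval shift p (oneAdd c)
      map_add' := fun p q => by simp
      map_smul' := fun k p => by simp }
  have hA : (LinearMap.range A).topologicalClosure = ⊤ := by
    rw [Submodule.topologicalClosure_eq_top_iff, Submodule.eq_bot_iff]
    intro f hf
    have hrec : ∀ n, f.coeff n + conj c * f.coeff (n + 1) = 0 := fun n => by
      have h1 : inner ℂ ((shift ^ n) (oneAdd c)) f = 0 := hf _ ⟨X ^ n, by simp [A]⟩
      rwa [shift_pow_oneAdd, inner_add_left, inner_smul_left, ← coeff_eq_inner_monomial,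
        ← coeff_eq_inner_monomial] at h1
    have hmono : Monotone fun n => ‖f.coeff n‖ ^ 2 := monotone_nat_of_le_succ fun n => by
      have h1 : ‖f.coeff n‖ ≤ ‖f.coeff (n + 1)‖ := by
        rw [eq_neg_of_add_eq_zero_left (hrec n), norm_neg, norm_mul, RCLike.norm_conj]
        exact mul_le_of_le_one_left (norm_nonneg _) hc
      gcongr
    refine ext_coeff fun n => ?_
    have h1 := hmono.ge_of_tendsto f.summable_sq.tendsto_atTop_zero n
    have h2 : ‖f.coeff n‖ = 0 := by
      have := le_antisymm h1 (by positivity)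
      exact pow_eq_zero_iff two_ne_zero |>.1 this
    rw [norm_eq_zero.1 h2, coeff_zero]
  exact congrArg (fun N : Submodule ℂ HardySpace => (N : Set HardySpace)) hA

/-! ### The subspaces spanned by the wandering functions -/

namespace IsWandering

variable {Θ : HardySpace} {θ : ℂ → ℂ} {a₀ b₀ : ℂ} {φ : HardySpace}

lemma mul_shift (h : IsWandering Θ) (f : HardySpace) : h.mul (shift f) = shift (h.mul f) :=
  ext_apply fun z => by
    rw [h.mul_apply, shift_apply, shift_apply, h.mul_apply]
    ring

lemma mul_monomial_zero (h : IsWandering Θ) : h.mul (monomial 0) = Θ := ext_apply fun z => by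
  rw [h.mul_apply, monomial_apply, pow_zero, mul_one]

lemma mem_multiples_iff (h : IsWandering Θ) (hΘ : ∀ z : Complex.UnitDisc, Θ z = θ z)
    {f : HardySpace} :
    f ∈ multiples (fun z => z * θ z) ↔ ∃ u, f = shift (h.mul u) := by
  have key : ∀ (u : HardySpace) (z : Complex.UnitDisc),
      shift (h.mul u) z = (z : ℂ) * θ z * u z := fun u z => by
    rw [shift_apply, h.mul_apply, hΘ, mul_assoc]
  constructor
  · rintro ⟨u, hu⟩
    exact ⟨u, ext_apply fun z => by rw [hu, key]⟩
  · rintro ⟨u, rfl⟩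
    exact ⟨u, key u⟩

/-- The relation `T φ = (1 + c z) θ` with `c = (b₀ / a₀) |θ(0)|²`. -/
lemma straighten_wandering (h : IsWandering Θ) (hΘ : ∀ z : Complex.UnitDisc, Θ z = θ z)
    (ha : a₀ ≠ 0) (hφ : ∀ z : Complex.UnitDisc, φ z = wanderingFunction a₀ b₀ θ z) :
    straighten b₀ ha φ = h.mul (oneAdd (b₀ / a₀ * (‖θ 0‖ : ℂ) ^ 2)) := ext_apply fun z => by
  rw [straighten_apply, h.mul_apply, oneAdd_apply, hφ, hφ, hΘ, coe_unitDisc_zero]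
  simp only [wanderingFunction]
  field_simp
  ring

/-- The subspace `ℂ φ + z θ H²` is the preimage of `θ H²` under `T`. -/
lemma mem_span_sup_multiples_iff (h : IsWandering Θ) (hΘ : ∀ z : Complex.UnitDisc, Θ z = θ z)
    (ha : a₀ ≠ 0) (hφ : ∀ z : Complex.UnitDisc, φ z = wanderingFunction a₀ b₀ θ z)
    {f : HardySpace} :
    f ∈ Submodule.span ℂ {φ} ⊔ multiples (fun z => z * θ z) ↔
      ∃ g, straighten b₀ ha f = h.mul g := by
  have hTφ := h.straighten_wandering hΘ ha hφ
  set p := oneAdd (b₀ / a₀ * (‖θ 0‖ : ℂ) ^ 2) with hp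
  have hp0 : p 0 = 1 := by rw [hp, oneAdd_apply, coe_unitDisc_zero, mul_zero, add_zero]
  rw [Submodule.mem_sup]
  constructor
  · rintro ⟨_, hk, _, hu, rfl⟩
    obtain ⟨k, rfl⟩ := Submodule.mem_span_singleton.1 hk
    obtain ⟨u, rfl⟩ := (h.mem_multiples_iff hΘ).1 hu
    refine ⟨k • p + shift u, ?_⟩
    rw [map_add, map_smul, hTφ, straighten_eq_self ha (shift_apply_zero _), map_add, map_smul,
      h.mul_shift]
  · rintro ⟨g, hg⟩
    obtain ⟨u, hu⟩ := exists_eq_shift (f := g - g 0 • p) (by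
      rw [sub_apply, smul_apply, hp0, mul_one, sub_self])
    have hT : straighten b₀ ha (f - g 0 • φ) = shift (h.mul u) := by
      rw [map_sub, map_smul, hTφ, hg, ← map_smul, ← map_sub, hu, h.mul_shift]
    have h0 : (f - g 0 • φ) 0 = 0 := by
      have h1 := straighten_apply_zero (b₀ := b₀) ha (f - g 0 • φ)
      rw [hT, shift_apply_zero] at h1
      exact (mul_eq_zero.1 h1.symm).resolve_left ha
    rw [straighten_eq_self ha h0] at hT
    exact ⟨g 0 • φ, Submodule.mem_span_singleton.2 ⟨_, rfl⟩, f - g 0 • φ,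
      (h.mem_multiples_iff hΘ).2 ⟨u, hT⟩, add_sub_cancel _ _⟩

end IsWandering

/-- The function `φ` as an explicit element of `H²`. -/
lemma coe_wanderingFunction {Θ : HardySpace} {θ : ℂ → ℂ}
    (hΘ : ∀ z : Complex.UnitDisc, Θ z = θ z) (a₀ b₀ : ℂ)
    (z : Complex.UnitDisc) :
    (Θ + (b₀ / a₀ * (‖θ 0‖ : ℂ) ^ 2) • shift Θ - (θ 0 / a₀) • affine a₀ b₀) z =
      wanderingFunction a₀ b₀ θ z := by
  simp only [sub_apply, add_apply, smul_apply, affine_apply, shift_apply, hΘ, wanderingFunction]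
  ring

namespace IsWandering

variable {Θ : HardySpace} {θ : ℂ → ℂ} {a₀ b₀ : ℂ} {φ : HardySpace}

lemma span_isOrtho_multiples (h : IsWandering Θ) (hΘ : ∀ z : Complex.UnitDisc, Θ z = θ z)
    (hφ : ∀ z : Complex.UnitDisc, φ z = wanderingFunction a₀ b₀ θ z) :
    Submodule.span ℂ {φ} ⟂ multiples (fun z => z * θ z) := by
  have hφ' : φ = Θ + (b₀ / a₀ * (‖θ 0‖ : ℂ) ^ 2) • shift Θ - (θ 0 / a₀) • affine a₀ b₀ :=
    ext_apply fun z => by rw [hφ, coe_wanderingFunction hΘ]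
  rw [Submodule.isOrtho_iff_inner_eq]
  intro v hv w hw
  obtain ⟨k, rfl⟩ := Submodule.mem_span_singleton.1 hv
  obtain ⟨u, rfl⟩ := (h.mem_multiples_iff hΘ).1 hw
  have h1 : inner ℂ Θ (shift (h.mul u)) = 0 := by
    rw [← h.mul_shift]
    nth_rewrite 1 [← h.mul_monomial_zero]
    rw [h.mul.inner_map_map, ← coeff_eq_inner_monomial, coeff_shift_zero]
  have h2 : inner ℂ (shift Θ) (shift (h.mul u)) = u 0 := by
    rw [inner_shift_shift]
    nth_rewrite 1 [← h.mul_monomial_zero]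
    rw [h.mul.inner_map_map, ← coeff_eq_inner_monomial, apply_zero]
  have h3 : inner ℂ (affine a₀ b₀) (shift (h.mul u)) = conj b₀ * (θ 0 * u 0) := by
    have h4 : θ 0 * u 0 = h.mul u 0 := by rw [h.mul_apply, hΘ, coe_unitDisc_zero]
    rw [affine, inner_add_left, inner_smul_left, inner_smul_left, ← coeff_eq_inner_monomial,
      ← coeff_eq_inner_monomial, coeff_shift_zero, mul_zero, zero_add, coeff_shift_succ, h4,
      apply_zero]
  have h5 : (‖θ 0‖ : ℂ) ^ 2 = θ 0 * conj (θ 0) := by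
    rw [Complex.mul_conj, Complex.normSq_eq_norm_sq, ofReal_pow]
  rw [inner_smul_left, hφ', inner_sub_left, inner_add_left, inner_smul_left, inner_smul_left,
    h1, h2, h3, h5]
  simp only [map_mul, map_div₀, conj_conj]
  ring

lemma ne_zero_of_wanderingFunction (h : IsWandering Θ) (hΘ : ∀ z : Complex.UnitDisc, Θ z = θ z)
    (ha : a₀ ≠ 0) (hφ : ∀ z : Complex.UnitDisc, φ z = wanderingFunction a₀ b₀ θ z) : φ ≠ 0 := by
  rintro rfl
  have h1 := h.straighten_wandering hΘ ha hφ
  rw [map_zero] at h1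
  exact oneAdd_ne_zero _ (h.mul.injective (by rw [← h1, map_zero]))

/-- `T` carries `p(S₁) T⁻¹ (Θ g)` to `Θ (p(M_z) g)`. -/
lemma straighten_aeval (ha : a₀ ≠ 0) (h : IsWandering Θ) {f g : HardySpace}
    (hfg : straighten b₀ ha f = h.mul g) (p : ℂ[X]) :
    straighten b₀ ha (aeval (perturbedShift a₀ b₀) p f) = h.mul (aeval shift p g) := by
  have hpow : ∀ n : ℕ, straighten b₀ ha ((perturbedShift a₀ b₀ ^ n) f) =
      h.mul ((shift ^ n) g) := fun n => by
    induction n with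
    | zero => simpa using hfg
    | succ n ih =>
      rw [pow_succ', mul_apply_eq_comp, straighten_perturbedShift, ih, pow_succ',
        mul_apply_eq_comp, h.mul_shift]
  induction p using Polynomial.induction_on' with
  | add p q hp hq => simp only [map_add, _root_.add_apply, hp, hq]
  | monomial n k =>
    simp only [← Polynomial.smul_X_eq_monomial, map_smul, map_pow, aeval_X,
      _root_.smul_apply, hpow]

lemma coe_span_sup_multiples_eq_cyclicSubspace (h : IsWandering Θ)
    (hΘ : ∀ z : Complex.UnitDisc, Θ z = θ z) (ha : a₀ ≠ 0) (hab : ‖b₀‖ ≤ ‖a₀‖)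
    (hφ : ∀ z : Complex.UnitDisc, φ z = wanderingFunction a₀ b₀ θ z) :
    ((Submodule.span ℂ {φ} ⊔ multiples (fun z => z * θ z) : Submodule ℂ HardySpace) :
      Set HardySpace) = cyclicSubspace (perturbedShift a₀ b₀) φ := by
  have hTφ := h.straighten_wandering hΘ ha hφ
  have hset : ((Submodule.span ℂ {φ} ⊔ multiples (fun z => z * θ z) : Submodule ℂ HardySpace) :
      Set HardySpace) = straighten b₀ ha ⁻¹' range h.mul := by
    ext f
    rw [SetLike.mem_coe, h.mem_span_sup_multiples_iff hΘ ha hφ]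
    exact exists_congr fun g => eq_comm
  rw [hset]
  refine Subset.antisymm ?_ (closure_minimal ?_ ?_)
  · rintro f ⟨g, hg⟩
    have hθ0 : ‖θ 0‖ ≤ 1 := by
      have := h.norm_apply_le_one 0
      rwa [hΘ, coe_unitDisc_zero] at this
    have hcyc : g ∈ closure (range fun p : ℂ[X] =>
        aeval shift p (oneAdd (b₀ / a₀ * (‖θ 0‖ : ℂ) ^ 2))) := by
      have := cyclicSubspace_shift_oneAdd (norm_mul_sq_le hab hθ0)
      rw [cyclicSubspace] at this
      rw [this]
      trivial
    have hf : f = (straighten b₀ ha).symm (h.mul g) := by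
      rw [hg, ContinuousLinearEquiv.symm_apply_apply]
    rw [hf]
    refine map_mem_closure (f := fun x => (straighten b₀ ha).symm (h.mul x))
      ((straighten b₀ ha).symm.continuous.comp h.mul.continuous) hcyc ?_
    rintro _ ⟨p, rfl⟩
    refine ⟨p, ?_⟩
    beta_reduce
    rw [← straighten_aeval ha h hTφ p, ContinuousLinearEquiv.symm_apply_apply]
  · rintro _ ⟨p, rfl⟩
    exact ⟨_, (straighten_aeval ha h hTφ p).symm⟩
  · exact h.mul.isometry.isClosedEmbedding.isClosed_range.preimage (straighten b₀ ha).continuous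

end IsWandering

end HardySpace

end

theorem mainTheorem6 (a₀ b₀ : ℂ) (hb : 0 < ‖b₀‖) (hab : ‖b₀‖ ≤ ‖a₀‖) :
    HardySpace.IsPerturbation 1 (HardySpace.perturbation a₀ b₀) ∧
    (∀ M : Submodule ℂ HardySpace, M ≠ ⊥ → IsClosed (M : Set HardySpace) →
      ((∀ f ∈ M, HardySpace.perturbedShift a₀ b₀ f ∈ M) ↔
        ∃ (θ : ℂ → ℂ) (φ : HardySpace), IsInnerFunction θ ∧
          (∀ z : Complex.UnitDisc, φ z = wanderingFunction a₀ b₀ θ z) ∧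
          Submodule.span ℂ {φ} ⟂ HardySpace.multiples (fun z => z * θ z) ∧
          M = Submodule.span ℂ {φ} ⊔ HardySpace.multiples (fun z => z * θ z))) ∧
    (∀ θ : ℂ → ℂ, IsInnerFunction θ →
      (∃ φ : HardySpace, ∀ z : Complex.UnitDisc, φ z = wanderingFunction a₀ b₀ θ z) ∧
      ∀ φ : HardySpace, (∀ z : Complex.UnitDisc, φ z = wanderingFunction a₀ b₀ θ z) →
        φ ≠ 0 ∧
        Submodule.span ℂ {φ} ⟂ HardySpace.multiples (fun z => z * θ z) ∧
        ((Submodule.span ℂ {φ} ⊔ HardySpace.multiples (fun z => z * θ z) :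
            Submodule ℂ HardySpace) : Set HardySpace) =
          cyclicSubspace (HardySpace.perturbedShift a₀ b₀) φ) := by
  have ha : a₀ ≠ 0 := norm_pos_iff.1 (hb.trans_le hab)
  refine ⟨HardySpace.isPerturbation_perturbation ha, fun M hM hcl => ⟨fun hinv => ?_, ?_⟩,
    fun θ hθ => ?_⟩
  · set T := HardySpace.straighten b₀ ha
    set N : Submodule ℂ HardySpace := M.map (T : HardySpace →ₗ[ℂ] HardySpace) with hN
    have hmem : ∀ f, T f ∈ N ↔ f ∈ M := fun f =>
      ⟨fun ⟨g, hg, hgf⟩ => T.injective hgf ▸ hg, fun hf => ⟨f, hf, rfl⟩⟩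
    have hNbot : N ≠ ⊥ := by
      obtain ⟨f, hf, hf0⟩ := M.exists_mem_ne_zero_of_ne_bot hM
      refine N.ne_bot_iff.2 ⟨T f, (hmem f).2 hf, fun h0 => hf0 (T.injective ?_)⟩
      rw [h0, map_zero]
    have hNcl : IsClosed (N : Set HardySpace) := T.toHomeomorph.isClosedMap _ hcl
    have hNinv : ∀ f ∈ N, HardySpace.shift f ∈ N := by
      rintro _ ⟨f, hf, rfl⟩
      exact (HardySpace.straighten_perturbedShift ha f) ▸ (hmem _).2 (hinv f hf)
    obtain ⟨Θ, h, hΘ⟩ := HardySpace.exists_isWandering_of_invariant hNbot hNcl hNinv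
    have hval : ∀ z : Complex.UnitDisc, Θ z = Θ.toFun z := fun _ => rfl
    have hφ := HardySpace.coe_wanderingFunction hval a₀ b₀
    refine ⟨Θ.toFun, _, h.isInnerFunction, hφ, h.span_isOrtho_multiples hval hφ, ?_⟩
    ext f
    rw [h.mem_span_sup_multiples_iff hval ha hφ, ← hmem, hΘ]
  · rintro ⟨θ, φ, hθ, hφ, -, rfl⟩ f hf
    obtain ⟨Θ, h, hΘ⟩ := hθ.exists_isWandering
    rw [h.mem_span_sup_multiples_iff hΘ ha hφ] at hf ⊢
    obtain ⟨g, hg⟩ := hf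
    exact ⟨HardySpace.shift g, by
      rw [HardySpace.straighten_perturbedShift, hg, h.mul_shift]⟩
  · obtain ⟨Θ, h, hΘ⟩ := hθ.exists_isWandering
    exact ⟨⟨_, HardySpace.coe_wanderingFunction hΘ a₀ b₀⟩, fun φ hφ =>
      ⟨h.ne_zero_of_wanderingFunction hΘ ha hφ, h.span_isOrtho_multiples hΘ hφ,
        h.coe_span_sup_multiples_eq_cyclicSubspace hΘ ha hab hφ⟩⟩
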